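/- Let $\mathbb T$ be the unit circle with normalized arclength $\mu$, let $H^2\subset L^2(\mathbb T)$ be the classical Hardy space, and for a subspace $\mathcal V\subset\mathbb C\oplus\mathbb Cz$ let $H^2_{\mathcal V}=H^2\ominus\mathcal V$. For real-valued $\phi\in L^\infty(\mathbb T)$ let $T^{\mathcal V}_\phi$ be the Toeplitz operator $f\mapsto P_{\mathcal V}(\phi f)$ on $H^2_{\mathcal V}$, where $P_{\mathcal V}$ is the orthogonal projection of $L^2(\mathbb T)$ onto $H^2_{\mathcal V}$. Suppose that there are $c\in\mathbb C$ and real numbers $m<0<M$ such that $$\operatorname{ess\,sup}\{\phi(z): cz+\overline{cz}<0\}=m<0<M=\operatorname{ess\,inf}\{\phi(z): cz+\overline{cz}>0\}.$$ With $H(z,t)=\frac{e^{it}+z}{e^{it}-z}$ put, for $|z|<1$ and $\lambda\in(m,M)$, $$h_c(z)=\exp\Big(\frac1{2\pi}\int_{-\pi}^{\pi}H(z,t)\log|ce^{it}+\bar c e^{-it}|^{1/2}\,dt\Big),\qquad g_\lambda(z)=\exp\Big(\frac1{2\pi}\int_{-\pi}^{\pi}H(z,t)\log|\phi(e^{it})-\lambda|^{-1/2}\,dt\Big).$$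 These logarithms are integrable, and $h_c$ and $g_\lambda$ are complex differentiable at $0$, so that a map $\Lambda:(m,M)\to\mathbb P^1(\mathbb C)$ is defined by $$\Lambda(\lambda)=\big[\,h_c(0)g_\lambda(0)\;:\;h_c'(0)g_\lambda(0)+h_c(0)g_\lambda'(0)\,\big].$$ Let $\mathbb P^1(\mathbb C)$ carry its usual (chordal) metric, in which the distance of two lines in $\mathbb C^2$ is the sine of the angle between them. Then: 1. $\Lambda$ is locally Lipschitz on $(m,M)$. 2. The image $\Lambda((m,M))$ has Hausdorff dimension at most one. 3. For $\mathcal V=\operatorname{span}\{1\}$ the operator $T^{\mathcal V}_\phi$ has no eigenvalues; besides this $\mathcal V$ there are other (indeed infinitely many) nonzero proper subspaces $\mathcal V\subset\mathbb C\oplus\mathbb Cz$ for which $T^{\mathcal V}_\phi$ has no eigenvalues. -/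

import Mathlib

open MeasureTheory Set AddCircle
open scoped ENNReal LinearAlgebra.Projectivization ComplexConjugate

noncomputable section

namespace NeilParabola

/-- The period `2π` is positive (this makes `AddCircle (2π)` a compact circle in Mathlib). -/
instance instFactTwoPiPos : Fact (0 < 2 * Real.pi) := ⟨Real.two_pi_pos⟩

/-- The unit circle, parametrized by the angle `t` modulo `2π`; the coordinate function
`z = e^{it}` is `fourier 1`. -/
abbrev Torus : Type := AddCircle (2 * Real.pi)

/-- Normalized arclength measure `dt / 2π`. -/
abbrev arc : Measure Torus := haarAddCircle

/-- The space `L²` of the circle. -/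
abbrev L2 : Type := Lp ℂ 2 arc

/-! ### Hardy space and its subspaces -/

/-- The Hardy space `H²`: the closure in `L²` of the span of `z ^ n`, `n = 0, 1, 2, …`. -/
def hardy : Submodule ℂ L2 :=
  (Submodule.span ℂ (range fun n : ℕ => (fourierLp 2 (n : ℤ) : L2))).topologicalClosure

/-- The space `ℂ ⊕ ℂ z` spanned in `L²` by `1` and `z`. -/
def linearPolys : Submodule ℂ L2 :=
  Submodule.span ℂ {(fourierLp 2 0 : L2), (fourierLp 2 1 : L2)}

/-- The span of the constant function `1`. -/
def constants : Submodule ℂ L2 :=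
  Submodule.span ℂ {(fourierLp 2 0 : L2)}

/-- `H²_V = H² ⊖ V`, the functions in `H²` that are orthogonal to `V`. -/
def hardySub (V : Submodule ℂ L2) : Submodule ℂ L2 := hardy ⊓ Vᗮ

theorem isClosed_hardySub (V : Submodule ℂ L2) : IsClosed (hardySub V : Set L2) :=
  (Submodule.isClosed_topologicalClosure _).inter (Submodule.isClosed_orthogonal V)

instance instCompleteHardySub (V : Submodule ℂ L2) : CompleteSpace (hardySub V) :=
  (isClosed_hardySub V).completeSpace_coe

/-! ### Toeplitz operators -/

/-- Multiplication by a real function `φ ∈ L^∞`, as a bounded operator on `L²`. -/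
def mulOp (φ : Lp ℝ ∞ arc) : L2 →L[ℂ] L2 :=
  LinearMap.mkContinuous
    { toFun := fun f => (φ • f : L2)
      map_add' := fun f g => Lp.add_smul φ f g
      map_smul' := fun a f => by
        refine Lp.ext ?_
        filter_upwards [Lp.coeFn_lpSMul φ (a • f) (r := 2), Lp.coeFn_lpSMul φ f (r := 2),
          Lp.coeFn_smul a f, Lp.coeFn_smul a (φ • f : L2)] with x h1 h2 h3 h4
        simp only [RingHom.id_apply]
        rw [h1, h4, Pi.smul_apply', Pi.smul_apply, h2, h3, Pi.smul_apply, Pi.smul_apply',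
          smul_comm] }
    ‖φ‖ (fun f => Lp.norm_smul_le φ f)

/-- The Toeplitz operator `f ↦ P_V (φ f)` on `H²_V`, where `P_V` is the orthogonal projection
of `L²` onto `H²_V`. -/
def toeplitz (φ : Lp ℝ ∞ arc) (V : Submodule ℂ L2) : hardySub V →L[ℂ] hardySub V :=
  (hardySub V).orthogonalProjectionOnto ∘L mulOp φ ∘L (hardySub V).subtypeL

/-- The Toeplitz operator with symbol `φ` on `H²_V` has no eigenvalues. -/
def NoEigenvalues (φ : Lp ℝ ∞ arc) (V : Submodule ℂ L2) : Prop :=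
  ∀ a : ℂ, ¬ Module.End.HasEigenvalue
    (toeplitz φ V : hardySub V →ₗ[ℂ] hardySub V) a

/-! ### The outer functions -/

/-- The real number `c z + (c z)^*` at the point `z = e^{it}`. -/
def neilWeight (c : ℂ) (t : Torus) : ℝ := 2 * (c * fourier 1 t).re

/-- The kernel `H(z, t) = (e^{it} + z) / (e^{it} - z)`. -/
def herglotz (z : ℂ) (t : Torus) : ℂ := (fourier 1 t + z) / (fourier 1 t - z)

/-- `z ↦ exp ((1 / 2π) ∫ H(z, t) u(t) dt)`; on the unit disc this is, for `u` integrable, the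
outer function whose modulus on the circle is `exp u`. -/
def outerExp (u : Torus → ℝ) (z : ℂ) : ℂ :=
  Complex.exp (∫ t, herglotz z t * (u t : ℂ) ∂arc)

/-- `log |c e^{it} + c^* e^{-it}|^{1/2}`. -/
def hLog (c : ℂ) (t : Torus) : ℝ := Real.log (|neilWeight c t| ^ (1 / 2 : ℝ))

/-- `log |φ(t) - λ|^{-1/2}`. -/
def gLog (φ : Lp ℝ ∞ arc) (lam : ℝ) (t : Torus) : ℝ := Real.log (|φ t - lam| ^ (-1 / 2 : ℝ))

/-- The function `h_c`. -/
def hFun (c : ℂ) : ℂ → ℂ := outerExp (hLog c)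

/-- The function `g_λ`. -/
def gFun (φ : Lp ℝ ∞ arc) (lam : ℝ) : ℂ → ℂ := outerExp (gLog φ lam)

/-! ### The complex projective line -/

/-- `ℂ²` with its Hermitian norm. -/
abbrev C2 : Type := EuclideanSpace ℂ (Fin 2)

/-- The orthogonal projection of `ℂ²` onto a line through the origin. -/
def lineProj (p : ℙ ℂ C2) : C2 →L[ℂ] C2 := p.submodule.starProjection

theorem lineProj_injective : Function.Injective lineProj := fun _ _ h =>
  Projectivization.submodule_injective (Submodule.starProjection_inj.1 h)

/-- The standard metric of the complex projective line: the distance of two lines is the operator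
norm of the difference of the orthogonal projections onto them, that is, the sine of the angle
between them (`|v₀ w₁ - v₁ w₀| / (‖v‖ ‖w‖)` for the lines through `v` and `w`). It is half the
chordal metric of the Riemann sphere, and is bi-Lipschitz equivalent to the metric of `ℂ` on compact
subsets of the two affine charts `[ζ, 1]` and `[1, ξ]`. -/
instance instMetricProjLine : MetricSpace (ℙ ℂ C2) :=
  MetricSpace.induced lineProj lineProj_injective inferInstance

/-- The vector `(h_c(0) g_λ(0), h_c'(0) g_λ(0) + h_c(0) g_λ'(0))`. -/
def lamVec (c : ℂ) (φ : Lp ℝ ∞ arc) (lam : ℝ) : C2 :=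
  !₂[hFun c 0 * gFun φ lam 0,
    deriv (hFun c) 0 * gFun φ lam 0 + hFun c 0 * deriv (gFun φ lam) 0]

theorem lamVec_ne_zero (c : ℂ) (φ : Lp ℝ ∞ arc) (lam : ℝ) : lamVec c φ lam ≠ 0 := by
  intro h
  have h0 : (lamVec c φ lam) 0 = 0 := by rw [h]; rfl
  have h1 : hFun c 0 * gFun φ lam 0 = 0 := h0
  exact mul_ne_zero (Complex.exp_ne_zero _) (Complex.exp_ne_zero _) h1

/-- The map `Λ`. -/
def lamMap (c : ℂ) (φ : Lp ℝ ∞ arc) (lam : ℝ) : ℙ ℂ C2 :=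
  Projectivization.mk ℂ (lamVec c φ lam) (lamVec_ne_zero c φ lam)

end NeilParabola

end

open NeilParabola

/-!
An eigenvalue of the symmetric operator `T_φ^V` is a real number `λ`. If `f ∈ H²_V` is an
eigenvector, then `(φ - λ) f` is orthogonal to `zⁿ` for `n ≥ 2`, so `g = z · conj ((φ - λ) f)`
lies in `H²`, and the real function `q = (φ - λ) |f|²` has only the frequencies `±1`:
`q = a z + conj (a z)`. Hence `f g = z q = conj a + a z²`. Here `a ≠ 0`, because otherwise `f`
vanishes on a half circle, so that `f(z) f(-z) = 0` and `f = 0`. The polynomial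
`conj a + a z²` has no zeros in the disc, so it is outer, and then so is its factor `f`. For outer
`f` the ratio `f'(0) / f(0)` is twice the first Fourier coefficient of
`log |f| = (log |q| - log |φ - λ|) / 2`. That of `log |q|` is zero, because `q` changes sign under
`z ↦ -z`; so `f'(0) / f(0) = ρ(λ)` with `ρ(λ)` the first Fourier coefficient of `-log |φ - λ|`. A
comparison of the signs of `q` and `c z + conj (c z)` gives `λ ∈ [m, M]`.

Similarly `Λ(λ) = [1 : ρ(λ)]`, and `ρ` is locally Lipschitz on `(m, M)`, so `ρ([m, M])` has
Hausdorff dimension at most one and misses infinitely many `ζ ∈ ℂ`. For each of these the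
condition `f'(0) = ζ f(0)`, which defines `H²_V` for a line `V` in `ℂ ⊕ ℂ z`, excludes
eigenvectors, as does `f(0) = 0`, which corresponds to `V = span {1}`.
-/

namespace NeilParabola

open Filter Topology

/-! ### Fourier series on the circle -/

section FourierCoeff

variable {T : ℝ}

theorem norm_fourier_apply (n : ℤ) (t : AddCircle T) : ‖fourier n t‖ = 1 := by
  rw [fourier_apply, Circle.norm_coe]

theorem fourier_ne_zero (n : ℤ) (t : AddCircle T) : fourier n t ≠ 0 :=
  norm_pos_iff.1 (norm_fourier_apply n t ▸ one_pos)

theorem fourier_natCast (n : ℕ) (t : AddCircle T) : fourier (n : ℤ) t = fourier 1 t ^ n := by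
  induction n with
  | zero => simp
  | succ n ih => rw [Nat.cast_succ, fourier_add, ih, pow_succ]

theorem fourier_mul_conj (n : ℤ) (t : AddCircle T) : fourier n t * conj (fourier n t) = 1 := by
  rw [Complex.mul_conj', norm_fourier_apply]; simp

theorem norm_ofReal_mul_fourier {r : ℝ} (hr : 0 ≤ r) (n : ℤ) (t : AddCircle T) :
    ‖(r : ℂ) * fourier n t‖ = r := by
  rw [norm_mul, norm_fourier_apply, mul_one, Complex.norm_of_nonneg hr]

theorem continuous_radial {F : ℂ → ℂ} {R r : ℝ} (hF : ContinuousOn F (Metric.ball 0 R))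
    (hr0 : 0 ≤ r) (hr : r < R) : Continuous fun t : AddCircle T => F (r * fourier 1 t) :=
  hF.comp_continuous (continuous_const.mul (map_continuous (fourier 1)))
    fun t => mem_ball_zero_iff.2 ((norm_ofReal_mul_fourier hr0 1 t).trans_lt hr)

variable [Fact (0 < T)]

theorem fourierCoeff_eq_integral_fourier_neg_mul (f : AddCircle T → ℂ) (n : ℤ) :
    fourierCoeff f n = ∫ t, fourier (-n) t * f t ∂haarAddCircle := rfl

theorem fourierCoeff_zero_eq_integral (f : AddCircle T → ℂ) :
    fourierCoeff f 0 = ∫ t, f t ∂haarAddCircle := by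
  simp [fourierCoeff]

theorem fourierCoeff_ofReal_zero (u : AddCircle T → ℝ) :
    fourierCoeff (fun t => (u t : ℂ)) 0 = (∫ t, u t ∂haarAddCircle : ℝ) := by
  exact (fourierCoeff_zero_eq_integral _).trans integral_ofReal

theorem fourierCoeff_fourier_mul (k : ℤ) (f : AddCircle T → ℂ) (n : ℤ) :
    fourierCoeff (fun t => fourier k t * f t) n = fourierCoeff f (n - k) := by
  simp only [fourierCoeff_eq_integral_fourier_neg_mul, ← mul_assoc, ← fourier_add]
  rw [neg_sub, sub_eq_neg_add]

theorem fourierCoeff_conj (f : AddCircle T → ℂ) (n : ℤ) :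
    fourierCoeff (fun t => conj (f t)) n = conj (fourierCoeff f (-n)) := by
  simp only [fourierCoeff_eq_integral_fourier_neg_mul, ← integral_conj, map_mul, neg_neg,
    fourier_neg]

theorem fourierCoeff_ofReal_neg (u : AddCircle T → ℝ) (n : ℤ) :
    fourierCoeff (fun t => (u t : ℂ)) (-n) = conj (fourierCoeff (fun t => (u t : ℂ)) n) := by
  rw [← neg_neg n, ← fourierCoeff_conj, neg_neg]
  simp only [Complex.conj_ofReal]

theorem fourierCoeff_comp_add_right (f : AddCircle T → ℂ) (s : AddCircle T) (n : ℤ) :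
    fourierCoeff (fun t => f (t + s)) n = fourier n s * fourierCoeff f n := by
  have hshift : ∀ t, fourier (-n) t * f (t + s) =
      fourier n s * (fourier (-n) (t + s) * f (t + s)) := fun t => by
    have : fourier (-n) (t + s) = fourier (-n) t * fourier (-n) s := by
      simp [fourier_apply, smul_add, toCircle_add]
    rw [this, fourier_neg (x := s)]
    linear_combination -fourier (-n) t * f (t + s) * fourier_mul_conj n s
  simp only [fourierCoeff_eq_integral_fourier_neg_mul, hshift]
  rw [integral_const_mul, integral_add_right_eq_self (fun t => fourier (-n) t * f t) s]

theorem fourierCoeff_sub {f g : AddCircle T → ℂ} (hf : Integrable f haarAddCircle)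
    (hg : Integrable g haarAddCircle) (n : ℤ) :
    fourierCoeff (fun t => f t - g t) n = fourierCoeff f n - fourierCoeff g n := by
  simp only [fourierCoeff, smul_sub]
  exact integral_sub (hf.fourier_smul _) (hg.fourier_smul _)

theorem norm_fourierCoeff_le (f : AddCircle T → ℂ) (n : ℤ) :
    ‖fourierCoeff f n‖ ≤ ∫ t, ‖f t‖ ∂haarAddCircle :=
  (norm_integral_le_integral_norm _).trans_eq <| by
    simp only [smul_eq_mul, norm_mul, norm_fourier_apply, one_mul]

theorem hasSum_fourierCoeff_mul {f g : AddCircle T → ℂ} (hf : MemLp f 2 haarAddCircle)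
    (hg : MemLp g 2 haarAddCircle) (n : ℤ) :
    HasSum (fun j => fourierCoeff f j * fourierCoeff g (n - j))
      (fourierCoeff (fun t => f t * g t) n) := by
  have hgn : MemLp (fun t => fourier n t * conj (g t)) 2 haarAddCircle :=
    hg.star.of_le_mul (c := 1)
      ((map_continuous (fourier n)).aestronglyMeasurable.mul hg.star.1)
      (ae_of_all _ fun t => by simp [norm_fourier_apply, -fourier_apply])
  have hcoeff_f (j : ℤ) : inner ℂ (fourierBasis j) (hf.toLp f) = fourierCoeff f j := by
    rw [← HilbertBasis.repr_apply_apply, fourierBasis_repr]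
    exact congrFun (fourierCoeff_congr_ae hf.coeFn_toLp) j
  have hcoeff_g (j : ℤ) :
      inner ℂ (hgn.toLp _) (fourierBasis j) = fourierCoeff g (n - j) := by
    rw [← inner_conj_symm, ← HilbertBasis.repr_apply_apply, fourierBasis_repr,
      congrFun (fourierCoeff_congr_ae hgn.coeFn_toLp) j, fourierCoeff_fourier_mul,
      fourierCoeff_conj, Complex.conj_conj, neg_sub]
  have hinner : inner ℂ (hgn.toLp _) (hf.toLp f) = fourierCoeff (fun t => f t * g t) n := by
    rw [L2.inner_def, fourierCoeff_eq_integral_fourier_neg_mul]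
    refine integral_congr_ae ?_
    filter_upwards [hf.coeFn_toLp, hgn.coeFn_toLp] with t hft hgt
    rw [hft, hgt, RCLike.inner_apply, map_mul, Complex.conj_conj, fourier_neg]
    ring
  rw [← hinner]
  refine (fourierBasis.hasSum_inner_mul_inner (hgn.toLp _) (hf.toLp f)).congr_fun fun j => ?_
  rw [hcoeff_f, hcoeff_g, mul_comm]

theorem integral_mul_eq_zero_of_fourierCoeff_eq_zero {q : AddCircle T → ℂ}
    (hq : Integrable q haarAddCircle) (h : ∀ n, fourierCoeff q n = 0) (g : C(AddCircle T, ℂ)) :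
    ∫ t, g t * q t ∂haarAddCircle = 0 := by
  have hint (g : C(AddCircle T, ℂ)) : Integrable (fun t => g t * q t) haarAddCircle :=
    hq.bdd_mul (map_continuous g).aestronglyMeasurable
      (ae_of_all _ fun t => g.norm_coe_le_norm t)
  let Φ : C(AddCircle T, ℂ) →L[ℂ] ℂ := LinearMap.mkContinuous
    { toFun := fun g => ∫ t, g t * q t ∂haarAddCircle
      map_add' := fun a b => by
        simp only [ContinuousMap.add_apply, add_mul]
        exact integral_add (hint a) (hint b)
      map_smul' := fun a b => by
        simp only [ContinuousMap.smul_apply, smul_eq_mul, mul_assoc, RingHom.id_apply]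
        exact integral_const_mul _ _ }
    (∫ t, ‖q t‖ ∂haarAddCircle) fun g => by
      refine (norm_integral_le_integral_norm _).trans ?_
      rw [mul_comm, ← integral_const_mul]
      refine integral_mono (hint g).norm (hq.norm.const_mul _) fun t => ?_
      simp only [norm_mul]
      gcongr
      exact g.norm_coe_le_norm t
  have hspan : (Submodule.span ℂ (range (fourier (T := T)))).topologicalClosure
      ≤ LinearMap.ker (Φ : C(AddCircle T, ℂ) →ₗ[ℂ] ℂ) := by
    refine Submodule.topologicalClosure_minimal _ (Submodule.span_le.2 ?_) Φ.isClosed_ker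
    rintro _ ⟨n, rfl⟩
    have hn := h (-n)
    rwa [fourierCoeff, neg_neg] at hn
  rw [span_fourier_closure_eq_top] at hspan
  exact hspan (Submodule.mem_top (x := g))

end FourierCoeff

theorem ae_eq_zero_of_forall_integral_continuousMap_mul_eq_zero {X : Type*} [TopologicalSpace X]
    [MeasurableSpace X] [BorelSpace X] [HasOuterApproxClosed X] {μ : Measure X} {q : X → ℂ}
    (hq : Integrable q μ) (h : ∀ g : C(X, ℂ), ∫ x, g x * q x ∂μ = 0) : q =ᵐ[μ] 0 := by
  refine ae_eq_zero_of_forall_setIntegral_isClosed_eq_zero hq fun s hs => ?_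
  rw [← integral_indicator hs.measurableSet]
  let g (n : ℕ) : C(X, ℂ) := ⟨fun x => ((hs.apprSeq n x : ℝ) : ℂ), by fun_prop⟩
  have hlim : Tendsto (fun n => ∫ x, g n x * q x ∂μ) atTop (𝓝 (∫ x, s.indicator q x ∂μ)) := by
    refine tendsto_integral_of_dominated_convergence (fun x => ‖q x‖)
      (fun n => (map_continuous (g n)).aestronglyMeasurable.mul hq.1) hq.norm
      (fun n => ae_of_all _ fun x => ?_) (ae_of_all _ fun x => ?_)
    · rw [norm_mul]
      refine mul_le_of_le_one_left (norm_nonneg _) ?_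
      simpa [g] using HasOuterApproxClosed.apprSeq_apply_le_one hs n x
    · have happr := tendsto_pi_nhds.1 (HasOuterApproxClosed.tendsto_apprSeq hs) x
      have hcast : Continuous fun y : NNReal => ((y : ℝ) : ℂ) := by fun_prop
      have hind : s.indicator q x = (((s.indicator (fun _ => 1) x : NNReal) : ℝ) : ℂ) * q x := by
        by_cases hx : x ∈ s <;> simp [hx]
      rw [hind]
      exact ((hcast.tendsto _).comp happr).mul_const (q x)
  exact tendsto_nhds_unique hlim (by simp only [h, tendsto_const_nhds])

theorem ae_eq_zero_of_fourierCoeff_eq_zero {T : ℝ} [Fact (0 < T)] {q : AddCircle T → ℂ}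
    (hq : Integrable q haarAddCircle) (h : ∀ n, fourierCoeff q n = 0) : q =ᵐ[haarAddCircle] 0 :=
  ae_eq_zero_of_forall_integral_continuousMap_mul_eq_zero hq
    (integral_mul_eq_zero_of_fourierCoeff_eq_zero hq h)

/-! ### Hardy functions and their extensions to the disc -/

section HardySpace

variable {T : ℝ} [Fact (0 < T)]

/-- `f` represents an element of the Hardy space `H²` of the circle: it is square integrable and
its Fourier coefficients of negative index vanish. -/
structure MemHardy (f : AddCircle T → ℂ) : Prop where
  memLp : MemLp f 2 haarAddCircle
  fourierCoeff_neg : ∀ n < 0, fourierCoeff f n = 0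

/-- The formal power series whose coefficients are the Fourier coefficients of `f` of nonnegative
index. -/
noncomputable def taylorSeries (f : AddCircle T → ℂ) : PowerSeries ℂ :=
  .mk fun n => fourierCoeff f n

/-- The function `z ↦ ∑ f̂(n) zⁿ` on the unit disc; its boundary function is `f` when `f` is a
Hardy function. -/
noncomputable def diskExt (f : AddCircle T → ℂ) (z : ℂ) : ℂ := ∑' n : ℕ, fourierCoeff f n * z ^ n

namespace MemHardy

variable {f g : AddCircle T → ℂ}

theorem integrable (hf : MemHardy f) : Integrable f haarAddCircle :=
  hf.memLp.integrable one_le_two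

theorem comp_add_right (hf : MemHardy f) (s : AddCircle T) : MemHardy fun t => f (t + s) :=
  ⟨hf.memLp.comp_measurePreserving (measurePreserving_add_right haarAddCircle s),
    fun n hn => by rw [fourierCoeff_comp_add_right, hf.fourierCoeff_neg n hn, mul_zero]⟩

theorem ae_eq_zero_of_taylorSeries_eq_zero (hf : MemHardy f) (h : taylorSeries f = 0) :
    f =ᵐ[haarAddCircle] 0 := by
  refine ae_eq_zero_of_fourierCoeff_eq_zero hf.integrable fun n => ?_
  obtain hn | hn := lt_or_ge n 0
  · exact hf.fourierCoeff_neg n hn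
  · lift n to ℕ using hn
    simpa [taylorSeries] using congrArg (PowerSeries.coeff n) h

theorem fourierCoeff_mul_of_neg (hf : MemHardy f) (hg : MemHardy g) {n : ℤ} (hn : n < 0) :
    fourierCoeff (fun t => f t * g t) n = 0 := by
  refine (hasSum_fourierCoeff_mul hf.memLp hg.memLp n).unique (hasSum_zero.congr_fun fun j => ?_)
  obtain hj | hj := lt_or_ge j 0
  · rw [hf.fourierCoeff_neg j hj, zero_mul]
  · rw [hg.fourierCoeff_neg _ (by omega), mul_zero]

theorem taylorSeries_mul (hf : MemHardy f) (hg : MemHardy g) :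
    taylorSeries (fun t => f t * g t) = taylorSeries f * taylorSeries g := by
  ext n
  simp only [taylorSeries, PowerSeries.coeff_mul, PowerSeries.coeff_mk]
  refine (hasSum_fourierCoeff_mul hf.memLp hg.memLp n).unique ?_
  rw [Finset.Nat.sum_antidiagonal_eq_sum_range_succ
    (fun i j => fourierCoeff f i * fourierCoeff g j)]
  have hsum := hasSum_sum_of_ne_finset_zero (L := .unconditional _)
    (s := (Finset.range (n + 1)).map Nat.castEmbedding)
    (f := fun j : ℤ => fourierCoeff f j * fourierCoeff g (n - j)) fun j hj => ?_
  · rw [Finset.sum_map] at hsum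
    convert hsum using 1
    refine Finset.sum_congr rfl fun k hk => ?_
    rw [Nat.castEmbedding_apply, Nat.cast_sub (Nat.lt_succ_iff.1 (Finset.mem_range.1 hk))]
  · obtain hj0 | hj0 := lt_or_ge j 0
    · rw [hf.fourierCoeff_neg j hj0, zero_mul]
    · lift j to ℕ using hj0
      have hnj : ¬ j < n + 1 := fun hlt => hj (Finset.mem_map_of_mem _ (Finset.mem_range.2 hlt))
      rw [hg.fourierCoeff_neg _ (by omega), mul_zero]

theorem ae_eq_zero_or_ae_eq_zero_of_mul (hf : MemHardy f) (hg : MemHardy g)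
    (hfg : (fun t => f t * g t) =ᵐ[haarAddCircle] 0) :
    f =ᵐ[haarAddCircle] 0 ∨ g =ᵐ[haarAddCircle] 0 := by
  have hmul : taylorSeries f * taylorSeries g = 0 := by
    rw [← hf.taylorSeries_mul hg]
    ext n
    simp only [taylorSeries, PowerSeries.coeff_mk, fourierCoeff_congr_ae hfg, map_zero]
    simp [fourierCoeff]
  exact (mul_eq_zero.1 hmul).imp hf.ae_eq_zero_of_taylorSeries_eq_zero
    hg.ae_eq_zero_of_taylorSeries_eq_zero

end MemHardy

theorem summable_norm_fourierCoeff_mul_pow (f : AddCircle T → ℂ) {z : ℂ} (hz : ‖z‖ < 1) :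
    Summable fun n : ℕ => ‖fourierCoeff f n * z ^ n‖ := by
  refine Summable.of_nonneg_of_le (fun n => norm_nonneg _) (fun n => ?_)
    ((summable_geometric_of_lt_one (norm_nonneg z) hz).mul_left (∫ t, ‖f t‖ ∂haarAddCircle))
  rw [norm_mul, norm_pow]
  gcongr
  exact norm_fourierCoeff_le f n

theorem hasFPowerSeriesOnBall_diskExt (f : AddCircle T → ℂ) :
    HasFPowerSeriesOnBall (diskExt f)
      (FormalMultilinearSeries.ofScalars ℂ fun n : ℕ => fourierCoeff f n) 0 1 := by
  set p := FormalMultilinearSeries.ofScalars ℂ fun n : ℕ => fourierCoeff f n with hp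
  have hradius : (1 : ℝ≥0∞) ≤ p.radius := by
    refine p.le_radius_of_bound (∫ t, ‖f t‖ ∂haarAddCircle) (r := 1) fun n => ?_
    rw [NNReal.coe_one, one_pow, mul_one, hp, FormalMultilinearSeries.ofScalars_norm]
    exact norm_fourierCoeff_le f n
  refine ((p.hasFPowerSeriesOnBall (zero_lt_one.trans_le hradius)).mono one_pos hradius).congr
    fun z _ => ?_
  rw [FormalMultilinearSeries.sum, diskExt]
  refine tsum_congr fun n => ?_
  rw [hp, FormalMultilinearSeries.ofScalars_apply_eq, smul_eq_mul]

theorem differentiableOn_diskExt (f : AddCircle T → ℂ) :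
    DifferentiableOn ℂ (diskExt f) (Metric.ball 0 1) := by
  have h := (hasFPowerSeriesOnBall_diskExt f).differentiableOn
  rwa [← ENNReal.ofReal_one, Metric.eball_ofReal] at h

theorem diskExt_zero (f : AddCircle T → ℂ) : diskExt f 0 = fourierCoeff f 0 := by
  rw [diskExt, tsum_eq_single 0 fun n hn => by simp [hn]]
  simp

theorem deriv_diskExt_zero (f : AddCircle T → ℂ) : deriv (diskExt f) 0 = fourierCoeff f 1 := by
  rw [(hasFPowerSeriesOnBall_diskExt f).hasFPowerSeriesAt.deriv,
    FormalMultilinearSeries.ofScalars_apply_eq]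
  simp

theorem MemHardy.diskExt_mul {f g : AddCircle T → ℂ} (hf : MemHardy f) (hg : MemHardy g) {z : ℂ}
    (hz : ‖z‖ < 1) : diskExt (fun t => f t * g t) z = diskExt f z * diskExt g z := by
  rw [diskExt, diskExt, diskExt, tsum_mul_tsum_eq_tsum_sum_antidiagonal_of_summable_norm
    (summable_norm_fourierCoeff_mul_pow f hz) (summable_norm_fourierCoeff_mul_pow g hz)]
  refine tsum_congr fun n => ?_
  have hcoeff := congrArg (PowerSeries.coeff n) (hf.taylorSeries_mul hg)
  simp only [taylorSeries, PowerSeries.coeff_mul, PowerSeries.coeff_mk] at hcoeff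
  rw [hcoeff, Finset.sum_mul]
  refine Finset.sum_congr rfl fun p hp => ?_
  rw [← Finset.HasAntidiagonal.mem_antidiagonal.1 hp, pow_add]
  ring

theorem hasSum_mul_fourierCoeff {ι : Type*} [Countable ι] {c : ι → ℂ}
    (hc : Summable fun i => ‖c i‖) (k : ι → ℤ) {u : AddCircle T → ℂ}
    (hu : Integrable u haarAddCircle) :
    HasSum (fun i => c i * fourierCoeff u (k i))
      (∫ t, (∑' i, c i * fourier (-k i) t) * u t ∂haarAddCircle) := by
  have hint (i : ι) : Integrable (fun t => c i * (fourier (-k i) t * u t)) haarAddCircle :=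
    (hu.fourier_smul (-k i)).const_mul (c i)
  have h := hasSum_integral_of_summable_integral_norm hint <| by
    simpa only [norm_mul, norm_fourier_apply, one_mul, integral_const_mul] using hc.mul_right _
  simp only [integral_const_mul, ← fourierCoeff_eq_integral_fourier_neg_mul] at h
  simpa only [← mul_assoc, tsum_mul_right] using h

theorem fourierCoeff_tsum_mul_fourier_pow {c : ℕ → ℂ} (hc : Summable fun n => ‖c n‖) (m : ℤ) :
    fourierCoeff (fun t : AddCircle T => ∑' n, c n * fourier 1 t ^ n) m =
      if 0 ≤ m then c m.toNat else 0 := by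
  have hint : Integrable (fourier (-m) : AddCircle T → ℂ) haarAddCircle :=
    (map_continuous _).integrable_of_hasCompactSupport (HasCompactSupport.of_compactSpace _)
  have hsum := hasSum_mul_fourierCoeff hc (fun n => -(n : ℤ)) hint
  simp only [neg_neg, fourier_natCast, fourierCoeff_fourier] at hsum
  simp only [fourierCoeff_eq_integral_fourier_neg_mul, mul_comm (fourier (-m) _)]
  refine hsum.unique ?_
  split_ifs with hm
  · lift m to ℕ using hm
    refine (hasSum_ite_eq m (c m)).congr_fun fun n => ?_
    obtain rfl | hn := eq_or_ne n m
    · simp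
    · rw [Pi.single_eq_of_ne (by omega), mul_zero, if_neg hn]
  · convert hasSum_zero (α := ℂ) (β := ℕ) using 2 with n
    rw [Pi.single_eq_of_ne (by omega), mul_zero]

theorem fourierCoeff_radial {F : ℂ → ℂ} {p : FormalMultilinearSeries ℂ ℂ ℂ} {R : ℝ≥0∞} {r : NNReal}
    (hF : HasFPowerSeriesOnBall F p 0 R) (hr : r < R) (m : ℤ) :
    fourierCoeff (fun t : AddCircle T => F (r * fourier 1 t)) m =
      if 0 ≤ m then p.coeff m.toNat * (r : ℂ) ^ m.toNat else 0 := by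
  have hsummable : Summable fun n => ‖p.coeff n * (r : ℂ) ^ n‖ := by
    simpa [FormalMultilinearSeries.norm_apply_eq_norm_coef] using
      p.summable_norm_mul_pow (hr.trans_le hF.r_le)
  rw [← fourierCoeff_tsum_mul_fourier_pow (T := T) hsummable]
  congr! 2 with t
  have hmem : (r : ℂ) * fourier 1 t ∈ Metric.eball (0 : ℂ) R := by
    rwa [mem_eball_zero_iff, ← enorm_norm, norm_ofReal_mul_fourier r.coe_nonneg,
      Real.enorm_eq_ofReal r.coe_nonneg, ENNReal.ofReal_coe_nnreal]
  rw [← zero_add ((r : ℂ) * fourier 1 t), ← (hF.hasSum hmem).tsum_eq]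
  refine tsum_congr fun n => ?_
  rw [FormalMultilinearSeries.apply_eq_pow_smul_coeff, smul_eq_mul]
  ring

end HardySpace

theorem integral_norm_le_sqrt_integral_norm_sq {X E : Type*} [MeasurableSpace X]
    [NormedAddCommGroup E] {μ : Measure X} [IsProbabilityMeasure μ] {f : X → E}
    (hf : MemLp f 2 μ) : ∫ x, ‖f x‖ ∂μ ≤ √(∫ x, ‖f x‖ ^ 2 ∂μ) := by
  have hvar := ProbabilityTheory.variance_nonneg (fun x => ‖f x‖) μ
  rw [ProbabilityTheory.variance_eq_sub hf.norm, sub_nonneg] at hvar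
  exact Real.le_sqrt_of_sq_le hvar

theorem exists_exp_eq_of_ne_zero {F : ℂ → ℂ} {c : ℂ} {R : ℝ} (hR : 0 < R)
    (hF : DifferentiableOn ℂ F (Metric.ball c R)) (hF0 : ∀ z ∈ Metric.ball c R, F z ≠ 0) :
    ∃ L : ℂ → ℂ, DifferentiableOn ℂ L (Metric.ball c R) ∧
      (∀ z ∈ Metric.ball c R, Complex.exp (L z) = F z) ∧ deriv L c = deriv F c / F c := by
  have hlogDeriv : DifferentiableOn ℂ (fun z => deriv F z / F z) (Metric.ball c R) :=
    (hF.deriv Metric.isOpen_ball).div hF hF0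
  obtain ⟨L, hLc, hL⟩ := hlogDeriv.isExactOn_ball.with_val_at c (Complex.log (F c))
  have hc : c ∈ Metric.ball c R := Metric.mem_ball_self hR
  refine ⟨L, fun z hz => (hL z hz).differentiableAt.differentiableWithinAt, fun z hz => ?_,
    (hL c hc).deriv⟩
  have hderiv (w : ℂ) (hw : w ∈ Metric.ball c R) :
      HasDerivAt (fun w => F w * Complex.exp (-L w)) 0 w := by
    have hFw := (hF.differentiableAt (Metric.isOpen_ball.mem_nhds hw)).hasDerivAt
    refine (hFw.mul (hL w hw).neg.cexp).congr_deriv ?_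
    have := hF0 w hw
    simp only [Pi.neg_apply]
    field_simp
    ring
  have hconst := Metric.isOpen_ball.is_const_of_deriv_eq_zero (convex_ball c R).isPreconnected
    (fun w hw => (hderiv w hw).differentiableAt.differentiableWithinAt)
    (fun w hw => (hderiv w hw).deriv) hz hc
  simp only [hLc] at hconst
  rw [Complex.exp_neg, Complex.exp_neg, Complex.exp_log (hF0 c hc),
    mul_inv_cancel₀ (hF0 c hc)] at hconst
  exact (eq_of_mul_inv_eq_one hconst).symm

section Circle

variable {T : ℝ} [Fact (0 < T)]

theorem integral_norm_sq_eq_tsum {f : AddCircle T → ℂ} (hf : MemLp f 2 haarAddCircle) :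
    ∫ t, ‖f t‖ ^ 2 ∂haarAddCircle = ∑' n, ‖fourierCoeff f n‖ ^ 2 := by
  rw [← fourierCoeff_congr_ae hf.coeFn_toLp, tsum_sq_fourierCoeff]
  exact integral_congr_ae (hf.coeFn_toLp.mono fun t ht => by simp only [ht])

theorem summable_sq_fourierCoeff {f : AddCircle T → ℂ} (hf : MemLp f 2 haarAddCircle) :
    Summable fun n => ‖fourierCoeff f n‖ ^ 2 := by
  rw [← fourierCoeff_congr_ae hf.coeFn_toLp]
  exact (hasSum_sq_fourierCoeff (hf.toLp f)).summable

theorem continuous_diskExt_radial (f : AddCircle T → ℂ) {r : ℝ} (hr : r ∈ Ico 0 1) :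
    Continuous fun t : AddCircle T => diskExt f (r * fourier 1 t) :=
  continuous_radial (differentiableOn_diskExt f).continuousOn hr.1 hr.2

theorem integrable_of_continuous {E : Type*} [NormedAddCommGroup E] {f : AddCircle T → E}
    (hf : Continuous f) : Integrable f haarAddCircle :=
  hf.integrable_of_hasCompactSupport (HasCompactSupport.of_compactSpace f)

namespace MemHardy

variable {f : AddCircle T → ℂ}

theorem memLp_diskExt_radial_sub (hf : MemHardy f) {r : ℝ} (hr : r ∈ Ico 0 1) :
    MemLp (fun t : AddCircle T => diskExt f (r * fourier 1 t) - f t) 2 haarAddCircle :=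
  ((continuous_diskExt_radial f hr).memLp_of_hasCompactSupport
    (HasCompactSupport.of_compactSpace _)).sub hf.memLp

theorem fourierCoeff_diskExt_radial_sub (hf : MemHardy f) {r : ℝ} (hr : r ∈ Ico 0 1) (n : ℤ) :
    fourierCoeff (fun t : AddCircle T => diskExt f (r * fourier 1 t) - f t) n =
      fourierCoeff f n * ((r : ℂ) ^ n.toNat - 1) := by
  rw [fourierCoeff_sub (integrable_of_continuous (continuous_diskExt_radial f hr)) hf.integrable]
  lift r to NNReal using hr.1
  rw [fourierCoeff_radial (hasFPowerSeriesOnBall_diskExt f) (by exact_mod_cast hr.2)]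
  split_ifs with hn
  · rw [FormalMultilinearSeries.coeff_ofScalars, Int.toNat_of_nonneg hn]
    ring
  · rw [hf.fourierCoeff_neg n (not_le.1 hn)]
    ring

theorem tendsto_integral_norm_sq_diskExt_radial_sub (hf : MemHardy f) :
    Tendsto (fun r : ℝ => ∫ t : AddCircle T, ‖diskExt f (r * fourier 1 t) - f t‖ ^ 2 ∂haarAddCircle)
      (𝓝[<] 1) (𝓝 0) := by
  have hlim : Tendsto (fun r : ℝ => ∑' n : ℤ, ‖fourierCoeff f n * ((r : ℂ) ^ n.toNat - 1)‖ ^ 2)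
      (𝓝[<] 1) (𝓝 (∑' _ : ℤ, 0)) := by
    refine tendsto_tsum_of_dominated_convergence (summable_sq_fourierCoeff hf.memLp)
      (fun n => ?_) ?_
    · have hcont : Continuous fun r : ℝ => ‖fourierCoeff f n * ((r : ℂ) ^ n.toNat - 1)‖ ^ 2 := by
        fun_prop
      simpa using (hcont.tendsto 1).mono_left nhdsWithin_le_nhds
    · filter_upwards [Ioo_mem_nhdsLT one_pos] with r hr n
      have hpow : ‖(r : ℂ) ^ n.toNat - 1‖ ≤ 1 := by
        rw [← Complex.ofReal_pow, ← Complex.ofReal_one, ← Complex.ofReal_sub, Complex.norm_real,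
          Real.norm_eq_abs, abs_le]
        have := pow_nonneg hr.1.le n.toNat
        have := pow_le_one₀ hr.1.le hr.2.le (n := n.toNat)
        constructor <;> linarith
      rw [Real.norm_of_nonneg (by positivity), norm_mul]
      gcongr
      exact mul_le_of_le_one_right (norm_nonneg _) hpow
  rw [tsum_zero] at hlim
  refine hlim.congr' ?_
  filter_upwards [Ioo_mem_nhdsLT one_pos] with r hr
  have hr' : r ∈ Ico (0 : ℝ) 1 := ⟨hr.1.le, hr.2⟩
  rw [integral_norm_sq_eq_tsum (hf.memLp_diskExt_radial_sub hr')]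
  simp only [hf.fourierCoeff_diskExt_radial_sub hr']

theorem tendsto_integral_norm_diskExt_radial_sub (hf : MemHardy f) :
    Tendsto (fun r : ℝ => ∫ t : AddCircle T, ‖diskExt f (r * fourier 1 t) - f t‖ ∂haarAddCircle)
      (𝓝[<] 1) (𝓝 0) := by
  have hsqrt := (Real.continuous_sqrt.tendsto 0).comp hf.tendsto_integral_norm_sq_diskExt_radial_sub
  rw [Real.sqrt_zero] at hsqrt
  refine tendsto_of_tendsto_of_tendsto_of_le_of_le' tendsto_const_nhds hsqrt
    (Eventually.of_forall fun r => integral_nonneg fun t => norm_nonneg _) ?_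
  filter_upwards [Ioo_mem_nhdsLT one_pos] with r hr
  exact integral_norm_le_sqrt_integral_norm_sq (hf.memLp_diskExt_radial_sub ⟨hr.1.le, hr.2⟩)

end MemHardy

/-- The `n`-th Fourier coefficient of `log |f|`; the value `log 0 = 0` at the zeros of `f` is
harmless because only functions that are nonzero almost everywhere matter. -/
noncomputable def logCoeff (f : AddCircle T → ℂ) (n : ℤ) : ℂ :=
  fourierCoeff (fun t => (Real.log ‖f t‖ : ℂ)) n

theorem fourierCoeff_re {f : AddCircle T → ℂ} (hf : Integrable f haarAddCircle) (n : ℤ) :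
    fourierCoeff (fun t => ((f t).re : ℂ)) n =
      (fourierCoeff f n + conj (fourierCoeff f (-n))) / 2 := by
  have hre : (fun t => ((f t).re : ℂ)) = fun t => (1 / 2 : ℂ) * (f t + conj (f t)) := by
    ext t
    rw [Complex.re_eq_add_conj]
    ring
  have hconj : Integrable (fun t => conj (f t)) haarAddCircle :=
    Complex.conjLIE.integrable_comp_iff.2 hf
  have hadd := congrFun (fourierCoeff.add hf hconj) n
  rw [hre, fourierCoeff.const_mul, ← fourierCoeff_conj, one_div, div_eq_inv_mul]
  exact congrArg _ hadd

theorem integral_one_add_re_mul_fourier_mul {u : AddCircle T → ℝ} (hu : Integrable u haarAddCircle)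
    (η : ℂ) :
    ∫ t, (1 + (η * fourier 1 t).re) * u t ∂haarAddCircle =
      ∫ t, u t ∂haarAddCircle + (conj η * fourierCoeff (fun t => (u t : ℂ)) 1).re := by
  have hint : Integrable (fun t => fourier (-1) t * (u t : ℂ)) haarAddCircle :=
    hu.ofReal.fourier_smul (-1)
  have hpt (t : AddCircle T) : (1 + (η * fourier 1 t).re) * u t =
      u t + (conj η * (fourier (-1) t * (u t : ℂ))).re := by
    rw [← mul_assoc, Complex.re_mul_ofReal, fourier_neg, ← map_mul, Complex.conj_re, add_mul,
      one_mul]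
  calc ∫ t, (1 + (η * fourier 1 t).re) * u t ∂haarAddCircle
      = ∫ t, u t + (conj η * (fourier (-1) t * (u t : ℂ))).re ∂haarAddCircle := by simp only [hpt]
    _ = ∫ t, u t ∂haarAddCircle + ∫ t, (conj η * (fourier (-1) t * (u t : ℂ))).re ∂haarAddCircle :=
      integral_add hu (hint.const_mul _).re
    _ = ∫ t, u t ∂haarAddCircle +
          (∫ t, conj η * (fourier (-1) t * (u t : ℂ)) ∂haarAddCircle).re :=
      congrArg _ (integral_re (hint.const_mul _))
    _ = _ := by rw [integral_const_mul, fourierCoeff_eq_integral_fourier_neg_mul]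

theorem logCoeff_radial {F : ℂ → ℂ} (hF : DifferentiableOn ℂ F (Metric.ball 0 1))
    (hF0 : ∀ z ∈ Metric.ball (0 : ℂ) 1, F z ≠ 0) {r : ℝ} (hr : r ∈ Ico 0 1) :
    logCoeff (fun t : AddCircle T => F (r * fourier 1 t)) 0 = Real.log ‖F 0‖ ∧
      logCoeff (fun t : AddCircle T => F (r * fourier 1 t)) 1 = r / 2 * (deriv F 0 / F 0) := by
  obtain ⟨L, hL, hexp, hderiv⟩ := exists_exp_eq_of_ne_zero one_pos hF hF0
  have hlog (z : ℂ) (hz : z ∈ Metric.ball (0 : ℂ) 1) : Real.log ‖F z‖ = (L z).re := by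
    rw [← hexp z hz, Complex.norm_exp, Real.log_exp]
  obtain ⟨R, hrR, hR⟩ := exists_between hr.2
  lift r to NNReal using hr.1
  lift R to NNReal using hr.1.trans hrR.le
  have hpow := (hL.mono (Metric.closedBall_subset_ball hR)).hasFPowerSeriesOnBall
    (by exact_mod_cast (zero_le (a := r)).trans_lt hrR)
  have hint := integrable_of_continuous (continuous_radial (T := T) hL.continuousOn hr.1 hr.2)
  have hre : (fun t : AddCircle T => (Real.log ‖F (r * fourier 1 t)‖ : ℂ)) =
      fun t => ((L (r * fourier 1 t)).re : ℂ) := by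
    ext t
    rw [hlog _ (mem_ball_zero_iff.2 ((norm_ofReal_mul_fourier hr.1 1 t).trans_lt hr.2))]
  have hrR' : (r : ℝ≥0∞) < R := by exact_mod_cast hrR
  have hcoeff_zero : (cauchyPowerSeries L 0 R).coeff 0 = L 0 := hpow.coeff_zero _
  have hcoeff_one : (cauchyPowerSeries L 0 R).coeff 1 = deriv F 0 / F 0 :=
    hpow.hasFPowerSeriesAt.deriv.symm.trans hderiv
  simp only [logCoeff, hre, fourierCoeff_re hint, fourierCoeff_radial hpow hrR',
    hlog 0 (Metric.mem_ball_self one_pos)]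
  constructor
  · simp [hcoeff_zero, Complex.re_eq_add_conj]
  · simp [hcoeff_one]
    ring

end Circle

/-! ### Jensen's inequality and outer functions -/

section LogNorm

variable {X E : Type*} [MeasurableSpace X] {μ : Measure X} [NormedAddCommGroup E]

theorem log_norm_le_log_norm_add {x y : E} (hx : x ≠ 0) {ε : ℝ} (hε : 0 < ε) :
    Real.log ‖x‖ ≤ Real.log (‖y‖ + ε) + ‖x - y‖ / ε := by
  have hy : 0 < ‖y‖ + ε := by positivity
  calc Real.log ‖x‖ ≤ Real.log (‖y‖ + ε + ‖x - y‖) := by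
        refine Real.log_le_log (norm_pos_iff.2 hx) ?_
        linarith [norm_le_norm_add_norm_sub' x y]
    _ = Real.log (‖y‖ + ε) + Real.log (1 + ‖x - y‖ / (‖y‖ + ε)) := by
        rw [← Real.log_mul hy.ne' (by positivity), mul_add, mul_one, mul_div_cancel₀ _ hy.ne']
    _ ≤ Real.log (‖y‖ + ε) + ‖x - y‖ / (‖y‖ + ε) := by
        gcongr
        linarith [Real.log_le_sub_one_of_pos (show 0 < 1 + ‖x - y‖ / (‖y‖ + ε) by positivity)]
    _ ≤ Real.log (‖y‖ + ε) + ‖x - y‖ / ε := by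
        gcongr
        linarith [norm_nonneg y]

theorem abs_log_norm_add_le {x : E} (hx : x ≠ 0) {ε : ℝ} (hε : ε ∈ Icc 0 1) :
    |Real.log (‖x‖ + ε)| ≤ |Real.log ‖x‖| + ‖x‖ := by
  have hx' := norm_pos_iff.2 hx
  have hmono := Real.log_le_log hx' (le_add_of_nonneg_right hε.1)
  have hlog := Real.log_le_sub_one_of_pos (add_pos_of_pos_of_nonneg hx' hε.1)
  rw [abs_le]
  constructor
  · linarith [neg_abs_le (Real.log ‖x‖)]
  · linarith [abs_nonneg (Real.log ‖x‖), hε.2]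

theorem integrable_log_norm_add {f : X → E} (hf : Integrable f μ) (hf0 : ∀ᵐ x ∂μ, f x ≠ 0)
    (hlog : Integrable (fun x => Real.log ‖f x‖) μ) {ε : ℝ} (hε : ε ∈ Icc 0 1) :
    Integrable (fun x => Real.log (‖f x‖ + ε)) μ := by
  refine (hlog.abs.add hf.norm).mono' (Real.measurable_log.comp_aemeasurable
    (hf.1.norm.aemeasurable.add_const ε)).aestronglyMeasurable ?_
  filter_upwards [hf0] with x hx using abs_log_norm_add_le hx hε

theorem tendsto_integral_mul_log_norm_add {f : X → E} {w : X → ℝ} {C : ℝ}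
    (hw : AEStronglyMeasurable w μ) (hwC : ∀ x, ‖w x‖ ≤ C) (hf : Integrable f μ)
    (hf0 : ∀ᵐ x ∂μ, f x ≠ 0) (hlog : Integrable (fun x => Real.log ‖f x‖) μ) :
    Tendsto (fun ε : ℝ => ∫ x, w x * Real.log (‖f x‖ + ε) ∂μ) (𝓝[>] 0)
      (𝓝 (∫ x, w x * Real.log ‖f x‖ ∂μ)) := by
  have hε : ∀ᶠ ε in 𝓝[>] (0 : ℝ), ε ∈ Icc 0 1 := Icc_mem_nhdsGT one_pos
  refine tendsto_integral_filter_of_dominated_convergence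
    (fun x => C * (|Real.log ‖f x‖| + ‖f x‖)) ?_ ?_ ((hlog.abs.add hf.norm).const_mul C) ?_
  · filter_upwards [hε] with ε hε using hw.mul (integrable_log_norm_add hf hf0 hlog hε).1
  · filter_upwards [hε] with ε hε
    filter_upwards [hf0] with x hx
    rw [norm_mul]
    exact mul_le_mul (hwC x) (abs_log_norm_add_le hx hε) (norm_nonneg _)
      ((norm_nonneg _).trans (hwC x))
  · filter_upwards [hf0] with x hx
    have hcont : ContinuousAt (fun ε : ℝ => w x * Real.log (‖f x‖ + ε)) 0 :=
      continuousAt_const.mul ((continuousAt_const.add continuousAt_id).log (by simpa using hx))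
    simpa using hcont.tendsto.mono_left nhdsWithin_le_nhds

theorem le_integral_mul_log_norm_of_tendsto {ι : Type*} {l : Filter ι} [l.NeBot] {F : ι → X → E}
    {f : X → E} {w : X → ℝ} {b C : ℝ} (hw : AEStronglyMeasurable w μ) (hwC : ∀ x, w x ∈ Icc 0 C)
    (hf : Integrable f μ) (hf0 : ∀ᵐ x ∂μ, f x ≠ 0) (hlog : Integrable (fun x => Real.log ‖f x‖) μ)
    (hF : ∀ᶠ i in l, Integrable (F i) μ) (hF0 : ∀ᶠ i in l, ∀ᵐ x ∂μ, F i x ≠ 0)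
    (hFlog : ∀ᶠ i in l, Integrable (fun x => Real.log ‖F i x‖) μ)
    (hlim : Tendsto (fun i => ∫ x, ‖F i x - f x‖ ∂μ) l (𝓝 0))
    (hb : Tendsto (fun i => ∫ x, w x * Real.log ‖F i x‖ ∂μ) l (𝓝 b)) :
    b ≤ ∫ x, w x * Real.log ‖f x‖ ∂μ := by
  have hwC' (x : X) : ‖w x‖ ≤ C := (Real.norm_of_nonneg (hwC x).1).trans_le (hwC x).2
  have hmul {u : X → ℝ} (hu : Integrable u μ) : Integrable (fun x => w x * u x) μ :=
    hu.bdd_mul hw (ae_of_all _ hwC')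
  refine ge_of_tendsto (tendsto_integral_mul_log_norm_add hw hwC' hf hf0 hlog) ?_
  filter_upwards [Ioc_mem_nhdsGT one_pos] with ε hε
  have hlogε := integrable_log_norm_add hf hf0 hlog ⟨hε.1.le, hε.2⟩
  have hupper := (hlim.const_mul (C / ε)).const_add (∫ x, w x * Real.log (‖f x‖ + ε) ∂μ)
  rw [mul_zero, add_zero] at hupper
  refine le_of_tendsto_of_tendsto hb hupper ?_
  filter_upwards [hF, hF0, hFlog] with i hFi hFi0 hFilog
  have hdist : Integrable (fun x => C / ε * ‖F i x - f x‖) μ := (hFi.sub hf).norm.const_mul _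
  rw [← integral_const_mul, ← integral_add (hmul hlogε) hdist]
  refine integral_mono_ae (hmul hFilog) ((hmul hlogε).add hdist) ?_
  filter_upwards [hFi0] with x hx
  calc w x * Real.log ‖F i x‖
      ≤ w x * (Real.log (‖f x‖ + ε) + ‖F i x - f x‖ / ε) :=
        mul_le_mul_of_nonneg_left (log_norm_le_log_norm_add hx hε.1) (hwC x).1
    _ = w x * Real.log (‖f x‖ + ε) + w x * (‖F i x - f x‖ / ε) := mul_add _ _ _
    _ ≤ w x * Real.log (‖f x‖ + ε) + C * (‖F i x - f x‖ / ε) := by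
        have := div_nonneg (norm_nonneg (F i x - f x)) hε.1.le
        gcongr
        exact (hwC x).2
    _ = w x * Real.log (‖f x‖ + ε) + C / ε * ‖F i x - f x‖ := by ring

theorem integrable_log_norm_of_mul {f g : X → ℂ} (hf : Integrable f μ) (hg : Integrable g μ)
    (hfg0 : ∀ᵐ x ∂μ, f x * g x ≠ 0) (hlog : Integrable (fun x => Real.log ‖f x * g x‖) μ) :
    Integrable (fun x => Real.log ‖f x‖) μ := by
  refine ((hlog.abs.add hf.norm).add hg.norm).mono'
    (Real.measurable_log.comp_aemeasurable hf.1.norm.aemeasurable).aestronglyMeasurable ?_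
  filter_upwards [hfg0] with x hx
  obtain ⟨hfx, hgx⟩ := mul_ne_zero_iff.1 hx
  have hmul : Real.log ‖f x * g x‖ = Real.log ‖f x‖ + Real.log ‖g x‖ := by
    rw [norm_mul, Real.log_mul (norm_ne_zero_iff.2 hfx) (norm_ne_zero_iff.2 hgx)]
  have hfle := Real.log_le_self (norm_nonneg (f x))
  have hgle := Real.log_le_self (norm_nonneg (g x))
  have hlow := neg_abs_le (Real.log ‖f x * g x‖)
  simp only [Pi.add_apply, Real.norm_eq_abs, abs_le]
  constructor <;> linarith [abs_nonneg (Real.log ‖f x * g x‖), norm_nonneg (f x), norm_nonneg (g x)]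

end LogNorm

section Jensen

variable {T : ℝ}

theorem one_add_re_mul_fourier_mem_Icc {η : ℂ} (hη : ‖η‖ ≤ 1) (t : AddCircle T) :
    1 + (η * fourier 1 t).re ∈ Icc (0 : ℝ) 2 := by
  have hre : |(η * fourier 1 t).re| ≤ 1 :=
    (Complex.abs_re_le_norm _).trans (by rwa [norm_mul, norm_fourier_apply, mul_one])
  rw [abs_le] at hre
  constructor <;> linarith [hre.1, hre.2]

variable [Fact (0 < T)]

theorem MemHardy.weighted_jensen {f : AddCircle T → ℂ} (hf : MemHardy f)
    (hz : ∀ z ∈ Metric.ball (0 : ℂ) 1, diskExt f z ≠ 0) (hf0 : ∀ᵐ t ∂haarAddCircle, f t ≠ 0)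
    (hlog : Integrable (fun t => Real.log ‖f t‖) haarAddCircle) {η : ℂ} (hη : ‖η‖ ≤ 1) :
    Real.log ‖fourierCoeff f 0‖ + (conj η * (fourierCoeff f 1 / fourierCoeff f 0)).re / 2 ≤
      ∫ t, Real.log ‖f t‖ ∂haarAddCircle + (conj η * logCoeff f 1).re := by
  have hIco : ∀ᶠ r in 𝓝[<] (1 : ℝ), r ∈ Ico 0 1 := Ico_mem_nhdsLT one_pos
  have hcont {r : ℝ} (hr : r ∈ Ico 0 1) := continuous_diskExt_radial f hr
  have hne {r : ℝ} (hr : r ∈ Ico 0 1) (t : AddCircle T) : diskExt f (r * fourier 1 t) ≠ 0 :=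
    hz _ (mem_ball_zero_iff.2 ((norm_ofReal_mul_fourier hr.1 1 t).trans_lt hr.2))
  have hint {r : ℝ} (hr : r ∈ Ico 0 1) := integrable_of_continuous
    ((hcont hr).norm.log fun t => norm_ne_zero_iff.2 (hne hr t))
  have hmean {r : ℝ} (hr : r ∈ Ico 0 1) :
      ∫ t : AddCircle T, (1 + (η * fourier 1 t).re) * Real.log ‖diskExt f (r * fourier 1 t)‖
        ∂haarAddCircle = Real.log ‖fourierCoeff f 0‖ +
          r * ((conj η * (fourierCoeff f 1 / fourierCoeff f 0)).re / 2) := by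
    obtain ⟨hzero, hone⟩ := logCoeff_radial (T := T) (differentiableOn_diskExt f) hz hr
    rw [logCoeff, fourierCoeff_ofReal_zero, Complex.ofReal_inj] at hzero
    have hscale (ρ : ℂ) : conj η * (r / 2 * ρ) = (r / 2 : ℝ) * (conj η * ρ) := by
      push_cast
      ring
    rw [integral_one_add_re_mul_fourier_mul (hint hr), hzero, ← logCoeff, hone, diskExt_zero,
      deriv_diskExt_zero, hscale, Complex.re_ofReal_mul, div_mul_eq_mul_div, mul_div_assoc]
  rw [logCoeff, ← integral_one_add_re_mul_fourier_mul hlog]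
  refine le_integral_mul_log_norm_of_tendsto (l := 𝓝[<] (1 : ℝ)) (by fun_prop)
    (one_add_re_mul_fourier_mem_Icc hη) hf.integrable hf0 hlog
    (hIco.mono fun r hr => integrable_of_continuous (hcont hr))
    (hIco.mono fun r hr => ae_of_all _ (hne hr)) (hIco.mono fun r hr => hint hr)
    hf.tendsto_integral_norm_diskExt_radial_sub ?_
  have hlim : Tendsto (fun r : ℝ => Real.log ‖fourierCoeff f 0‖ +
      r * ((conj η * (fourierCoeff f 1 / fourierCoeff f 0)).re / 2)) (𝓝 1) (𝓝 (_ + 1 * _)) :=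
    (tendsto_id.mul_const _).const_add _
  rw [one_mul] at hlim
  exact (hlim.mono_left nhdsWithin_le_nhds).congr' (hIco.mono fun r hr => (hmean hr).symm)

/-- `f` represents an outer function of the Hardy space, that is, equality holds in Jensen's
inequality `log |f̂(0)| ≤ ∫ log |f|`. Equality forces the extension of `f` to the disc to have no
zeros; this is recorded as a field so that it does not have to be derived from Jensen's formula. -/
structure IsOuter (f : AddCircle T → ℂ) : Prop extends MemHardy f where
  ae_ne_zero : ∀ᵐ t ∂haarAddCircle, f t ≠ 0
  integrable_log : Integrable (fun t => Real.log ‖f t‖) haarAddCircle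
  diskExt_ne_zero : ∀ z ∈ Metric.ball (0 : ℂ) 1, diskExt f z ≠ 0
  log_norm_fourierCoeff_zero : Real.log ‖fourierCoeff f 0‖ = ∫ t, Real.log ‖f t‖ ∂haarAddCircle

namespace IsOuter

variable {f g : AddCircle T → ℂ}

theorem fourierCoeff_one_div (hf : IsOuter f) :
    fourierCoeff f 1 / fourierCoeff f 0 = 2 * logCoeff f 1 := by
  -- Jensen's inequality with the weight of direction `d / |d|` reads `|d| / 2 ≤ 0`.
  obtain ⟨d, hd⟩ : ∃ d, d = fourierCoeff f 1 / fourierCoeff f 0 - 2 * logCoeff f 1 := ⟨_, rfl⟩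
  have hη : ‖d / ‖d‖‖ ≤ 1 := by
    rw [norm_div, Complex.norm_real, norm_norm]
    exact div_self_le_one _
  have hjensen := hf.weighted_jensen hf.diskExt_ne_zero hf.ae_ne_zero hf.integrable_log hη
  have hnorm : conj (d / ‖d‖) * (fourierCoeff f 1 / fourierCoeff f 0) =
      ‖d‖ + (2 : ℝ) * (conj (d / ‖d‖) * logCoeff f 1) := by
    have hdd : conj (d / ‖d‖) * d = ‖d‖ := by
      rw [map_div₀, Complex.conj_ofReal, div_mul_eq_mul_div, Complex.conj_mul', pow_two,
        mul_self_div_self]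
    rw [Complex.ofReal_ofNat]
    linear_combination hdd - conj (d / ‖d‖) * hd
  rw [hnorm, hf.log_norm_fourierCoeff_zero, Complex.add_re, Complex.ofReal_re,
    Complex.re_ofReal_mul] at hjensen
  exact sub_eq_zero.1 (hd ▸ norm_le_zero_iff.1 (by linarith))

theorem congr_ae (hf : IsOuter f) (hfg : f =ᵐ[haarAddCircle] g) : IsOuter g := by
  have hcoeff := fourierCoeff_congr_ae hfg
  have hlog : (fun t => Real.log ‖f t‖) =ᵐ[haarAddCircle] fun t => Real.log ‖g t‖ :=
    hfg.mono fun t ht => by simp only [ht]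
  refine ⟨⟨hf.memLp.ae_eq hfg, hcoeff ▸ hf.fourierCoeff_neg⟩, ?_, hf.integrable_log.congr hlog,
    ?_, ?_⟩
  · filter_upwards [hf.ae_ne_zero, hfg] with t ht h using h ▸ ht
  · simpa only [diskExt, hcoeff] using hf.diskExt_ne_zero
  · rw [← hcoeff, hf.log_norm_fourierCoeff_zero, integral_congr_ae hlog]

theorem of_mul_left (hf : MemHardy f) (hg : MemHardy g) (hfg : IsOuter fun t => f t * g t) :
    IsOuter f := by
  have hgf : IsOuter fun t => g t * f t := by simpa only [mul_comm] using hfg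
  have hlogf := integrable_log_norm_of_mul hf.integrable hg.integrable hfg.ae_ne_zero
    hfg.integrable_log
  have hlogg := integrable_log_norm_of_mul hg.integrable hf.integrable hgf.ae_ne_zero
    hgf.integrable_log
  have hf0 := hfg.ae_ne_zero.mono fun t ht => left_ne_zero_of_mul ht
  have hg0 := hfg.ae_ne_zero.mono fun t ht => right_ne_zero_of_mul ht
  have hz (z : ℂ) (hz : z ∈ Metric.ball (0 : ℂ) 1) : diskExt f z * diskExt g z ≠ 0 := by
    rw [← hf.diskExt_mul hg (mem_ball_zero_iff.1 hz)]
    exact hfg.diskExt_ne_zero z hz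
  have hzf (z : ℂ) (h : z ∈ Metric.ball (0 : ℂ) 1) := left_ne_zero_of_mul (hz z h)
  have hzg (z : ℂ) (h : z ∈ Metric.ball (0 : ℂ) 1) := right_ne_zero_of_mul (hz z h)
  refine ⟨hf, hf0, hlogf, hzf, ?_⟩
  have hjf := hf.weighted_jensen hzf hf0 hlogf (η := 0) (by simp)
  have hjg := hg.weighted_jensen hzg hg0 hlogg (η := 0) (by simp)
  simp only [map_zero, zero_mul, Complex.zero_re, zero_div, add_zero] at hjf hjg
  have hsum : ∫ t, Real.log ‖f t * g t‖ ∂haarAddCircle =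
      ∫ t, Real.log ‖f t‖ ∂haarAddCircle + ∫ t, Real.log ‖g t‖ ∂haarAddCircle := by
    rw [← integral_add hlogf hlogg]
    refine integral_congr_ae ?_
    filter_upwards [hf0, hg0] with t hft hgt
    rw [norm_mul, Real.log_mul (norm_ne_zero_iff.2 hft) (norm_ne_zero_iff.2 hgt)]
  have hcoeff : fourierCoeff (fun t => f t * g t) 0 = fourierCoeff f 0 * fourierCoeff g 0 := by
    simpa only [diskExt_zero] using hf.diskExt_mul hg (z := 0) (by simp)
  have hmean := hfg.log_norm_fourierCoeff_zero
  have h0 := hz 0 (Metric.mem_ball_self one_pos)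
  rw [diskExt_zero, diskExt_zero, mul_ne_zero_iff] at h0
  rw [hcoeff, norm_mul, Real.log_mul (norm_ne_zero_iff.2 h0.1) (norm_ne_zero_iff.2 h0.2),
    hsum] at hmean
  linarith

end IsOuter

end Jensen

/-! ### The weight `a z + conj (a z)` -/

/-- The rotation of the circle by the angle `π`, as an element of the additive group of angles. -/
noncomputable def halfTurn : Torus := (Real.pi : ℝ)

theorem fourier_one_add_halfTurn (t : Torus) : fourier 1 (t + halfTurn) = -fourier 1 t := by
  simpa [halfTurn, mul_div_cancel_left₀, -fourier_apply] using
    fourier_add_half_inv_index one_ne_zero Real.two_pi_pos t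

section Polynomial

open Polynomial

theorem fourier_one_eq_circleMap (θ : ℝ) : fourier 1 (θ : Torus) = circleMap 0 1 θ := by
  simp [toCircle_apply_mk, circleMap]

theorem toAddCircle_apply (p : ℂ[X]) (t : Torus) : p.toAddCircle t = p.eval (fourier 1 t) := by
  simp [toAddCircle, aeval_def, eval₂_eq_sum_range, eval_eq_sum_range]

theorem integral_comp_fourier_one (f : ℂ → ℝ) :
    ∫ t, f (fourier 1 t) ∂arc = Real.circleAverage f 0 1 := by
  rw [Real.circleAverage_def, integral_haarAddCircle,
    ← AddCircle.intervalIntegral_preimage (2 * Real.pi) 0]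
  simp_rw [fourier_one_eq_circleMap, zero_add]

theorem integrable_comp_fourier_one {f : ℂ → ℝ} (hf : Measurable f)
    (hint : CircleIntegrable f 0 1) : Integrable (fun t => f (fourier 1 t)) arc := by
  have hIoc : IntegrableOn (fun θ : ℝ => f (fourier 1 (θ : Torus))) (Ioc 0 (0 + 2 * Real.pi)) := by
    rw [← intervalIntegrable_iff_integrableOn_Ioc_of_le (by linarith [Real.two_pi_pos])]
    simp_rw [fourier_one_eq_circleMap, zero_add]
    exact hint
  have hvol := ((AddCircle.measurePreserving_mk (2 * Real.pi) 0).integrable_comp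
    (hf.comp (map_continuous (fourier 1)).measurable).aestronglyMeasurable).1 hIoc
  rw [volume_eq_smul_haarAddCircle] at hvol
  exact (integrable_smul_measure (by simp [Real.pi_pos]) ENNReal.ofReal_ne_top).1 hvol

instance : Nontrivial Torus :=
  ⟨halfTurn, 0, fun h => fourier_ne_zero 1 (0 : Torus) <| self_eq_neg.1 <| by
    rw [← fourier_one_add_halfTurn, h, add_zero]⟩

theorem ae_eval_fourier_one_ne_zero {p : ℂ[X]} (hp : p ≠ 0) :
    ∀ᵐ t : Torus ∂arc, p.eval (fourier 1 t) ≠ 0 := by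
  have hfin : {t : Torus | p.IsRoot (fourier 1 t)}.Finite := by
    refine p.finite_setOfPred_isRoot hp |>.preimage fun s _ t _ hst => ?_
    refine AddCircle.injective_toCircle Real.two_pi_pos.ne' (Subtype.ext ?_)
    simpa only [fourier_one] using hst
  rw [ae_iff]
  simpa only [not_not, IsRoot.def] using hfin.measure_zero arc

theorem mahlerMeasure_eq_norm_coeff_zero {p : ℂ[X]} (hp : ∀ z ∈ Metric.ball 0 1, p.eval z ≠ 0) :
    p.mahlerMeasure = ‖p.coeff 0‖ := by
  have hmax : p.roots.map (fun a => max 1 ‖a‖) = p.roots.map fun a => ‖a‖ := by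
    refine Multiset.map_congr rfl fun a ha => max_eq_right ?_
    by_contra! hlt
    exact hp a (mem_ball_zero_iff.2 hlt) (isRoot_of_mem_roots ha)
  rw [mahlerMeasure_eq_leadingCoeff_mul_prod_roots, hmax,
    (IsAlgClosed.splits p).coeff_zero_eq_leadingCoeff_mul_prod_roots, norm_mul, norm_mul, norm_pow,
    norm_neg, norm_one, one_pow, one_mul]
  congr 1
  exact (map_multiset_prod (normHom : ℂ →*₀ ℝ) _).symm

theorem fourierCoeff_eval_fourier_one (p : ℂ[X]) (n : ℤ) :
    fourierCoeff (fun t : Torus => p.eval (fourier 1 t)) n =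
      if 0 ≤ n then p.coeff n.natAbs else 0 := by
  simp only [← fourierCoeff_toAddCircle, ← toAddCircle_apply]

theorem diskExt_eval_fourier_one (p : ℂ[X]) :
    diskExt (fun t : Torus => p.eval (fourier 1 t)) = p.eval := by
  ext z
  rw [diskExt, eval_eq_sum, Polynomial.sum, tsum_eq_sum (s := p.support) fun n hn => ?_]
  · simp [fourierCoeff_eval_fourier_one, -fourier_apply]
  · simp [fourierCoeff_eval_fourier_one, notMem_support_iff.1 hn, -fourier_apply]

theorem isOuter_eval_fourier_one {p : ℂ[X]} (hp : ∀ z ∈ Metric.ball 0 1, p.eval z ≠ 0) :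
    IsOuter fun t : Torus => p.eval (fourier 1 t) where
  memLp := by
    simp only [← toAddCircle_apply]
    exact .of_bound (map_continuous _).aestronglyMeasurable _
      (ae_of_all _ p.toAddCircle.norm_coe_le_norm)
  fourierCoeff_neg n hn := by rw [fourierCoeff_eval_fourier_one, if_neg hn.not_ge]
  ae_ne_zero := ae_eval_fourier_one_ne_zero fun h => hp 0 (by simp) (by simp [h])
  integrable_log := integrable_comp_fourier_one (f := fun z => Real.log ‖p.eval z‖) (by fun_prop)
    p.intervalIntegrable_mahlerMeasure
  diskExt_ne_zero := by rwa [diskExt_eval_fourier_one]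
  log_norm_fourierCoeff_zero := by
    rw [integral_comp_fourier_one fun z => Real.log ‖p.eval z‖,
      ← logMahlerMeasure_def, logMahlerMeasure_eq_log_MahlerMeasure,
      mahlerMeasure_eq_norm_coeff_zero hp, fourierCoeff_eval_fourier_one]
    rfl

end Polynomial

section NeilWeight

open Polynomial

theorem ofReal_neilWeight (a : ℂ) (t : Torus) :
    (neilWeight a t : ℂ) = a * fourier 1 t + conj a * fourier (-1) t := by
  rw [neilWeight, fourier_neg, ← map_mul, Complex.add_conj]

@[fun_prop]
theorem continuous_neilWeight (a : ℂ) : Continuous (neilWeight a) := by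
  unfold neilWeight
  fun_prop

theorem neilWeight_add_halfTurn (a : ℂ) (t : Torus) :
    neilWeight a (t + halfTurn) = -neilWeight a t := by
  rw [neilWeight, neilWeight, fourier_one_add_halfTurn, mul_neg, Complex.neg_re, mul_neg]

theorem isOuter_fourier_one_mul_neilWeight {a : ℂ} (ha : a ≠ 0) :
    IsOuter fun t => fourier 1 t * (neilWeight a t : ℂ) := by
  have heval (t : Torus) : fourier 1 t * (neilWeight a t : ℂ) =
      (C (conj a) + C a * X ^ 2).eval (fourier 1 t) := by
    rw [ofReal_neilWeight, fourier_neg]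
    simp only [eval_add, eval_C, eval_mul, eval_pow, eval_X]
    linear_combination (conj a) * fourier_mul_conj 1 t
  simp only [heval]
  refine isOuter_eval_fourier_one fun z hz hzero => ?_
  simp only [eval_add, eval_C, eval_mul, eval_pow, eval_X] at hzero
  have hnorm : ‖a‖ * ‖z‖ ^ 2 = ‖a‖ := by
    rw [← norm_pow, ← norm_mul, ← Complex.norm_conj a, ← norm_neg (conj a),
      neg_eq_of_add_eq_zero_right hzero]
  have hsq : ‖z‖ ^ 2 < 1 := pow_lt_one₀ (norm_nonneg z) (mem_ball_zero_iff.1 hz) two_ne_zero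
  exact hsq.ne ((mul_eq_left₀ (norm_ne_zero_iff.2 ha)).1 hnorm)

theorem ae_neilWeight_ne_zero {a : ℂ} (ha : a ≠ 0) : ∀ᵐ t ∂arc, neilWeight a t ≠ 0 :=
  (isOuter_fourier_one_mul_neilWeight ha).ae_ne_zero.mono fun _ ht =>
    Complex.ofReal_ne_zero.1 (right_ne_zero_of_mul ht)

theorem integrable_log_norm_neilWeight {a : ℂ} (ha : a ≠ 0) :
    Integrable (fun t => Real.log ‖(neilWeight a t : ℂ)‖) arc := by
  simpa only [norm_mul, norm_fourier_apply, one_mul] using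
    (isOuter_fourier_one_mul_neilWeight ha).integrable_log

theorem logCoeff_neilWeight_one (a : ℂ) : logCoeff (fun t => (neilWeight a t : ℂ)) 1 = 0 := by
  have h := fourierCoeff_comp_add_right
    (fun t => (Real.log ‖(neilWeight a t : ℂ)‖ : ℂ)) halfTurn 1
  have hhalf : fourier 1 halfTurn = (-1 : ℂ) := by
    simpa only [zero_add, fourier_eval_zero] using fourier_one_add_halfTurn 0
  simp only [neilWeight_add_halfTurn, Complex.ofReal_neg, norm_neg] at h
  rw [hhalf, neg_one_mul] at h
  exact self_eq_neg.1 h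

theorem fourierCoeff_neilWeight (a : ℂ) (n : ℤ) :
    fourierCoeff (fun t => (neilWeight a t : ℂ)) n =
      a * (Pi.single 1 1 : ℤ → ℂ) n + conj a * (Pi.single (-1) 1 : ℤ → ℂ) n := by
  have hint (b : ℂ) (k : ℤ) : Integrable (fun t : Torus => b * fourier k t) arc :=
    integrable_of_continuous (by fun_prop)
  simp only [ofReal_neilWeight]
  have hadd := congrFun (fourierCoeff.add (hint a 1) (hint (conj a) (-1))) n
  rw [Pi.add_apply, fourierCoeff.const_mul, fourierCoeff.const_mul, fourierCoeff_fourier,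
    fourierCoeff_fourier] at hadd
  exact hadd

theorem ae_eq_neilWeight {q : Torus → ℝ} (hq : Integrable q arc)
    (h0 : fourierCoeff (fun t => (q t : ℂ)) 0 = 0)
    (hneg : ∀ n < -1, fourierCoeff (fun t => (q t : ℂ)) n = 0) :
    q =ᵐ[arc] neilWeight (fourierCoeff (fun t => (q t : ℂ)) 1) := by
  set a := fourierCoeff (fun t => (q t : ℂ)) 1 with ha
  have hw : Integrable (neilWeight a) arc := integrable_of_continuous (by fun_prop)
  have hdiff (n : ℤ) : fourierCoeff (fun t => ((q t - neilWeight a t : ℝ) : ℂ)) n =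
      fourierCoeff (fun t => (q t : ℂ)) n - fourierCoeff (fun t => (neilWeight a t : ℂ)) n := by
    simp only [Complex.ofReal_sub]
    exact fourierCoeff_sub hq.ofReal hw.ofReal n
  have hnonpos (n : ℤ) (hn : n ≤ 0) :
      fourierCoeff (fun t => ((q t - neilWeight a t : ℝ) : ℂ)) n = 0 := by
    rw [hdiff, fourierCoeff_neilWeight]
    obtain rfl | rfl | hn := show n = 0 ∨ n = -1 ∨ n < -1 by omega
    · simp [h0]
    · rw [fourierCoeff_ofReal_neg, ← ha]
      simp
    · rw [hneg n hn, Pi.single_eq_of_ne (by omega), Pi.single_eq_of_ne (by omega)]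
      simp
  have hzero : (fun t => ((q t - neilWeight a t : ℝ) : ℂ)) =ᵐ[arc] 0 := by
    refine ae_eq_zero_of_fourierCoeff_eq_zero (hq.sub hw).ofReal fun n => ?_
    obtain hn | hn := le_total n 0
    · exact hnonpos n hn
    · rw [← neg_neg n, fourierCoeff_ofReal_neg, hnonpos (-n) (by omega), map_zero]
  exact hzero.mono fun t ht => sub_eq_zero.1 (Complex.ofReal_eq_zero.1 ht)

end NeilWeight

theorem MemHardy.ae_eq_zero_of_mul_comp_add_right {T : ℝ} [Fact (0 < T)] {f : AddCircle T → ℂ}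
    (hf : MemHardy f) {s : AddCircle T} (h : (fun t => f t * f (t + s)) =ᵐ[haarAddCircle] 0) :
    f =ᵐ[haarAddCircle] 0 := by
  refine (hf.ae_eq_zero_or_ae_eq_zero_of_mul (hf.comp_add_right s) h).elim id fun hs => ?_
  have hback := (eventually_add_right_iff haarAddCircle (-s)).2 hs
  simp only [neg_add_cancel_right] at hback
  exact hback

theorem MemHardy.ae_eq_zero_of_neilWeight_pos {f : Torus → ℂ} (hf : MemHardy f) {c : ℂ}
    (hc : c ≠ 0) (h : ∀ᵐ t ∂arc, 0 < neilWeight c t → f t = 0) : f =ᵐ[arc] 0 := by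
  refine hf.ae_eq_zero_of_mul_comp_add_right (s := halfTurn) ?_
  have hturn := (eventually_add_right_iff arc halfTurn).2 h
  filter_upwards [h, hturn, ae_neilWeight_ne_zero hc] with t ht hts hne
  rw [neilWeight_add_halfTurn, neg_pos] at hts
  obtain hlt | hgt := hne.lt_or_gt
  · rw [hts hlt, mul_zero, Pi.zero_apply]
  · rw [ht hgt, zero_mul, Pi.zero_apply]

/-! ### Factorization of eigenvectors -/

section Factorization

theorem memHardy_fourier_mul_conj {T : ℝ} [Fact (0 < T)] {f : AddCircle T → ℂ}
    (hf : MemLp f 2 haarAddCircle) {k : ℤ} (h : ∀ n > k, fourierCoeff f n = 0) :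
    MemHardy fun t => fourier k t * conj (f t) where
  memLp := hf.star.of_le_mul (c := 1)
    ((map_continuous (fourier k)).aestronglyMeasurable.mul hf.star.1)
    (ae_of_all _ fun t => by simp [norm_fourier_apply, -fourier_apply])
  fourierCoeff_neg n hn := by
    rw [fourierCoeff_fourier_mul, fourierCoeff_conj, h _ (by omega), map_zero]

variable {ψ : Torus → ℝ} {f : Torus → ℂ} {a : ℂ}

theorem mul_fourier_one_mul_conj_eq (ψ : Torus → ℝ) (f : Torus → ℂ) (t : Torus) :
    f t * (fourier 1 t * conj (ψ t * f t)) = fourier 1 t * ((ψ t * ‖f t‖ ^ 2 : ℝ) : ℂ) := by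
  push_cast
  rw [map_mul, Complex.conj_ofReal, ← Complex.conj_mul']
  ring

theorem MemHardy.exists_ae_eq_neilWeight (hf : MemHardy f)
    (hg : MemHardy fun t => fourier 1 t * conj (ψ t * f t))
    (h0 : fourierCoeff (fun t => ((ψ t * ‖f t‖ ^ 2 : ℝ) : ℂ)) 0 = 0) :
    ∃ a, (fun t => ψ t * ‖f t‖ ^ 2) =ᵐ[arc] neilWeight a := by
  have hq : Integrable (fun t => ((ψ t * ‖f t‖ ^ 2 : ℝ) : ℂ)) arc := by
    have hfg := (hf.memLp.integrable_mul hg.memLp).fourier_smul (-1)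
    refine hfg.congr (ae_of_all _ fun t => ?_)
    simp only [Pi.mul_apply, mul_fourier_one_mul_conj_eq, smul_eq_mul]
    rw [← mul_assoc, ← fourier_add, neg_add_cancel, fourier_zero, one_mul]
  refine ⟨_, ae_eq_neilWeight hq.re h0 fun n hn => ?_⟩
  have hneg := hf.fourierCoeff_mul_of_neg hg (show n + 1 < 0 by omega)
  simpa only [mul_fourier_one_mul_conj_eq, fourierCoeff_fourier_mul, add_sub_cancel_right]
    using hneg

theorem MemHardy.isOuter_of_ae_eq_neilWeight (hf : MemHardy f)
    (hg : MemHardy fun t => fourier 1 t * conj (ψ t * f t)) (ha : a ≠ 0)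
    (hq : (fun t => ψ t * ‖f t‖ ^ 2) =ᵐ[arc] neilWeight a) : IsOuter f := by
  refine .of_mul_left hf hg ((isOuter_fourier_one_mul_neilWeight ha).congr_ae ?_)
  filter_upwards [hq] with t ht
  rw [mul_fourier_one_mul_conj_eq, ht]

/-- The first Fourier coefficient of `-log |φ - λ|`. -/
noncomputable def logMoment (φ : Torus → ℝ) (lam : ℝ) : ℂ :=
  -logCoeff (fun t => ((φ t - lam : ℝ) : ℂ)) 1

theorem IsOuter.fourierCoeff_one_div_eq_logMoment {φ : Torus → ℝ} {lam : ℝ} (hf : IsOuter f)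
    (ha : a ≠ 0) (hq : (fun t => (φ t - lam) * ‖f t‖ ^ 2) =ᵐ[arc] neilWeight a) :
    fourierCoeff f 1 / fourierCoeff f 0 = logMoment φ lam := by
  have hlog : (fun t => (Real.log ‖((φ t - lam : ℝ) : ℂ)‖ : ℂ)) =ᵐ[arc] fun t =>
      (Real.log ‖(neilWeight a t : ℂ)‖ : ℂ) - (2 * Real.log ‖f t‖ : ℝ) := by
    filter_upwards [hq, ae_neilWeight_ne_zero ha] with t ht hne
    rw [← ht] at hne
    have hlog_mul := Real.log_mul (left_ne_zero_of_mul hne) (right_ne_zero_of_mul hne)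
    rw [Real.log_pow, ht, Nat.cast_ofNat] at hlog_mul
    simp only [Complex.norm_real, Real.norm_eq_abs, Real.log_abs, hlog_mul]
    push_cast
    ring
  have hcoeff : logCoeff (fun t => ((φ t - lam : ℝ) : ℂ)) 1 =
      logCoeff (fun t => (neilWeight a t : ℂ)) 1 - 2 * logCoeff f 1 := by
    have hsub := fourierCoeff_sub (integrable_log_norm_neilWeight ha).ofReal
      (hf.integrable_log.const_mul 2).ofReal 1
    simp only [logCoeff, fourierCoeff_congr_ae hlog, ← fourierCoeff.const_mul]
    simpa using hsub
  rw [hf.fourierCoeff_one_div, logMoment, hcoeff, logCoeff_neilWeight_one]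
  ring

end Factorization

section Sign

variable {φ : Torus → ℝ} {f : Torus → ℂ} {a c : ℂ} {m M lam : ℝ}

theorem ae_neilWeight_pos_iff_ae_neilWeight_neg :
    (∀ᵐ t ∂arc, 0 < neilWeight c t → 0 < neilWeight a t) ↔
      ∀ᵐ t ∂arc, neilWeight c t < 0 → neilWeight a t < 0 := by
  have hturn {p : Torus → Prop} (h : ∀ᵐ t ∂arc, p t) : ∀ᵐ t ∂arc, p (t + halfTurn) :=
    (eventually_add_right_iff arc halfTurn).2 h
  constructor <;> intro h <;>
    simpa only [neilWeight_add_halfTurn, neg_pos, neg_neg_iff_pos] using hturn h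

theorem neilWeight_neg (t : Torus) : neilWeight (-c) t = -neilWeight c t := by
  rw [neilWeight, neilWeight, neg_mul, Complex.neg_re, mul_neg]

theorem ne_zero_of_isLeast
    (hm : IsLeast {r : ℝ | ∀ᵐ t ∂arc, neilWeight c t < 0 → φ t ≤ r} m) : c ≠ 0 := by
  rintro rfl
  have hle := hm.2 (show m - 1 ∈ _ from ae_of_all _ fun t ht => by simp [neilWeight] at ht)
  linarith

theorem MemHardy.ae_eq_zero_of_sub_mul_ae_eq_zero (hf : MemHardy f) (hc : c ≠ 0) (hmM : m < M)
    (hm : ∀ᵐ t ∂arc, neilWeight c t < 0 → φ t ≤ m)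
    (hM : ∀ᵐ t ∂arc, 0 < neilWeight c t → M ≤ φ t)
    (hq : (fun t => (φ t - lam) * ‖f t‖ ^ 2) =ᵐ[arc] 0) : f =ᵐ[arc] 0 := by
  have hne : ∀ᵐ t ∂arc, φ t ≠ lam → f t = 0 := by
    filter_upwards [hq] with t ht hlam
    simpa using (mul_eq_zero.1 ht).resolve_left (sub_ne_zero.2 hlam)
  obtain hlam | hlam := lt_or_ge lam M
  · refine hf.ae_eq_zero_of_neilWeight_pos hc ?_
    filter_upwards [hne, hM] with t h hMt hpos
    exact h (hlam.trans_le (hMt hpos)).ne'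
  · refine hf.ae_eq_zero_of_neilWeight_pos (neg_ne_zero.2 hc) ?_
    filter_upwards [hne, hm] with t h hmt hpos
    have hneg : neilWeight c t < 0 := by rwa [neilWeight_neg, neg_pos] at hpos
    exact h (((hmt hneg).trans_lt hmM).trans_le hlam).ne

theorem mem_Icc_of_sub_mul_ae_eq_neilWeight (hmM : m < M)
    (hm : IsLeast {r : ℝ | ∀ᵐ t ∂arc, neilWeight c t < 0 → φ t ≤ r} m)
    (hM : IsGreatest {r : ℝ | ∀ᵐ t ∂arc, 0 < neilWeight c t → r ≤ φ t} M) (ha : a ≠ 0)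
    (hq : (fun t => (φ t - lam) * ‖f t‖ ^ 2) =ᵐ[arc] neilWeight a) : lam ∈ Icc m M := by
  have hpos : ∀ᵐ t ∂arc, 0 < neilWeight a t ↔ lam < φ t := by
    filter_upwards [hq, ae_neilWeight_ne_zero ha] with t ht hne
    rw [← ht] at hne ⊢
    rw [mul_pos_iff_of_pos_right ((sq_nonneg _).lt_of_ne' (right_ne_zero_of_mul hne)), sub_pos]
  have hneg : ∀ᵐ t ∂arc, neilWeight a t < 0 ↔ φ t < lam := by
    filter_upwards [hq, ae_neilWeight_ne_zero ha] with t ht hne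
    rw [← ht] at hne ⊢
    rw [← neg_pos, ← neg_mul, neg_sub,
      mul_pos_iff_of_pos_right ((sq_nonneg _).lt_of_ne' (right_ne_zero_of_mul hne)), sub_pos]
  constructor <;> by_contra! hlt
  · have hright : ∀ᵐ t ∂arc, 0 < neilWeight c t → 0 < neilWeight a t := by
      filter_upwards [hM.1, hpos] with t hMt hiff ht
      exact hiff.2 ((hlt.trans hmM).trans_le (hMt ht))
    refine hlt.not_ge (hm.2 ?_)
    filter_upwards [ae_neilWeight_pos_iff_ae_neilWeight_neg.1 hright, hneg] with t h hiff ht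
    exact (hiff.1 (h ht)).le
  · have hleft : ∀ᵐ t ∂arc, neilWeight c t < 0 → neilWeight a t < 0 := by
      filter_upwards [hm.1, hneg] with t hmt hiff ht
      exact hiff.2 ((hmt ht).trans_lt (hmM.trans hlt))
    refine hlt.not_ge (hM.2 ?_)
    filter_upwards [ae_neilWeight_pos_iff_ae_neilWeight_neg.2 hleft, hpos] with t h hiff ht
    exact (hiff.1 (h ht)).le

end Sign

section Toeplitz

variable {φ : Lp ℝ ∞ arc} {V : Submodule ℂ L2} {c : ℂ} {m M : ℝ}

theorem inner_fourierLp {T : ℝ} [Fact (0 < T)] (n : ℤ)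
    (f : Lp ℂ 2 (haarAddCircle (T := T))) :
    inner ℂ (fourierLp 2 n : Lp ℂ 2 (haarAddCircle (T := T))) f = fourierCoeff f n := by
  rw [← fourierBasis_repr, HilbertBasis.repr_apply_apply, coe_fourierBasis]

theorem memHardy_of_mem_hardy {f : L2} (hf : f ∈ hardy) : MemHardy f where
  memLp := Lp.memLp f
  fourierCoeff_neg n hn := by
    have hle : hardy ≤ (ℂ ∙ (fourierLp 2 n : L2))ᗮ := by
      refine Submodule.topologicalClosure_minimal _ (Submodule.span_le.2 ?_)
        (Submodule.isClosed_orthogonal _)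
      rintro _ ⟨k, rfl⟩
      exact Submodule.mem_orthogonal_singleton_iff_inner_right.2 (orthonormal_fourier.2 (by omega))
    rw [← inner_fourierLp]
    exact Submodule.mem_orthogonal_singleton_iff_inner_right.1 (hle hf)

theorem fourierLp_mem_hardySub (hV : V ≤ linearPolys) {n : ℤ} (hn : 2 ≤ n) :
    (fourierLp 2 n : L2) ∈ hardySub V := by
  refine ⟨?_, Submodule.orthogonal_le hV (Submodule.mem_orthogonal' _ _ |>.2 fun u hu => ?_)⟩
  · lift n to ℕ using by omega
    exact Submodule.le_topologicalClosure _ (Submodule.subset_span ⟨n, rfl⟩)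
  · obtain ⟨a, b, rfl⟩ := Submodule.mem_span_pair.1 hu
    have h0 : inner ℂ (fourierLp 2 n : L2) (fourierLp 2 0) = 0 :=
      orthonormal_fourier.2 (by omega)
    have h1 : inner ℂ (fourierLp 2 n : L2) (fourierLp 2 1) = 0 :=
      orthonormal_fourier.2 (by omega)
    rw [inner_add_right, inner_smul_right, inner_smul_right, h0, h1, mul_zero, mul_zero, add_zero]

theorem coeFn_mulOp (φ : Lp ℝ ∞ arc) (f : L2) : mulOp φ f =ᵐ[arc] fun t => (φ t : ℂ) * f t :=
  (Lp.coeFn_lpSMul φ f (r := 2)).trans (ae_of_all _ fun _ => Complex.real_smul)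

theorem inner_toeplitz (φ : Lp ℝ ∞ arc) (V : Submodule ℂ L2) (x y : hardySub V) :
    inner ℂ y (toeplitz φ V x) = inner ℂ (y : L2) (mulOp φ (x : L2)) :=
  Submodule.inner_orthogonalProjectionOnto_eq_of_mem_left y _

theorem inner_mulOp (φ : Lp ℝ ∞ arc) (f g : L2) :
    inner ℂ g (mulOp φ f) = inner ℂ (mulOp φ g) f := by
  rw [L2.inner_def, L2.inner_def]
  refine integral_congr_ae ?_
  filter_upwards [coeFn_mulOp φ f, coeFn_mulOp φ g] with t hf hg
  simp only [hf, hg, RCLike.inner_apply, map_mul, Complex.conj_ofReal]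
  ring

theorem isSymmetric_toeplitz (φ : Lp ℝ ∞ arc) (V : Submodule ℂ L2) :
    (toeplitz φ V : hardySub V →ₗ[ℂ] hardySub V).IsSymmetric := fun x y => by
  rw [ContinuousLinearMap.coe_coe, inner_toeplitz, ← inner_conj_symm, inner_toeplitz,
    inner_conj_symm, inner_mulOp]

theorem exists_mulOp_sub_mem_orthogonal_of_hasEigenvalue {μ : ℂ}
    (h : Module.End.HasEigenvalue (toeplitz φ V : hardySub V →ₗ[ℂ] hardySub V) μ) :
    ∃ lam : ℝ, ∃ f ∈ hardySub V, f ≠ 0 ∧ mulOp φ f - (lam : ℂ) • f ∈ (hardySub V)ᗮ := by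
  obtain ⟨lam, rfl⟩ :=
    Complex.conj_eq_iff_real.1 ((isSymmetric_toeplitz φ V).conj_eigenvalue_eq_self h)
  obtain ⟨x, hx⟩ := h.exists_hasEigenvector
  have hTx : toeplitz φ V x = (lam : ℂ) • x := hx.apply_eq_smul
  refine ⟨lam, x, x.2, fun h0 => hx.2 (Subtype.ext h0),
    (Submodule.mem_orthogonal _ _).2 fun y hy => ?_⟩
  have hinner := inner_toeplitz φ V x ⟨y, hy⟩
  rw [hTx] at hinner
  rw [inner_sub_right, ← hinner]
  exact sub_self _

theorem coeFn_mulOp_sub (φ : Lp ℝ ∞ arc) (f : L2) (lam : ℝ) :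
    mulOp φ f - (lam : ℂ) • f =ᵐ[arc] fun t => ((φ t - lam : ℝ) : ℂ) * f t := by
  filter_upwards [Lp.coeFn_sub (mulOp φ f) ((lam : ℂ) • f), coeFn_mulOp φ f,
    Lp.coeFn_smul (lam : ℂ) f] with t hsub hmul hsmul
  rw [hsub, Pi.sub_apply, hmul, hsmul, Pi.smul_apply, smul_eq_mul, Complex.ofReal_sub, sub_mul]

theorem memHardy_of_mulOp_sub_mem_orthogonal (hV : V ≤ linearPolys) {f : L2} {lam : ℝ}
    (h : mulOp φ f - (lam : ℂ) • f ∈ (hardySub V)ᗮ) :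
    MemHardy fun t => fourier 1 t * conj (((φ t - lam : ℝ) : ℂ) * f t) := by
  refine memHardy_fourier_mul_conj ((memLp_congr_ae (coeFn_mulOp_sub φ f lam)).1 (Lp.memLp _))
    fun n hn => ?_
  rw [← fourierCoeff_congr_ae (coeFn_mulOp_sub φ f lam), ← inner_fourierLp]
  exact (Submodule.mem_orthogonal _ _).1 h _ (fourierLp_mem_hardySub hV hn)

theorem fourierCoeff_zero_eq_zero_of_mulOp_sub_mem_orthogonal {f : L2} (hf : f ∈ hardySub V)
    {lam : ℝ} (h : mulOp φ f - (lam : ℂ) • f ∈ (hardySub V)ᗮ) :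
    fourierCoeff (fun t => (((φ t - lam) * ‖f t‖ ^ 2 : ℝ) : ℂ)) 0 = 0 := by
  rw [fourierCoeff_zero_eq_integral, ← (Submodule.mem_orthogonal _ _).1 h f hf, L2.inner_def]
  refine integral_congr_ae ?_
  filter_upwards [coeFn_mulOp_sub φ f lam] with t ht
  rw [ht, RCLike.inner_apply, mul_assoc, Complex.mul_conj']
  push_cast
  rfl

theorem exists_fourierCoeff_one_div_eq_of_hasEigenvalue (hmM : m < M)
    (hm : IsLeast {r : ℝ | ∀ᵐ t ∂arc, neilWeight c t < 0 → φ t ≤ r} m)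
    (hM : IsGreatest {r : ℝ | ∀ᵐ t ∂arc, 0 < neilWeight c t → r ≤ φ t} M)
    (hV : V ≤ linearPolys) {μ : ℂ}
    (h : Module.End.HasEigenvalue (toeplitz φ V : hardySub V →ₗ[ℂ] hardySub V) μ) :
    ∃ lam ∈ Icc m M, ∃ f ∈ hardySub V, fourierCoeff f 0 ≠ 0 ∧
      fourierCoeff f 1 / fourierCoeff f 0 = logMoment φ lam := by
  obtain ⟨lam, f, hfV, hf0, horth⟩ := exists_mulOp_sub_mem_orthogonal_of_hasEigenvalue h
  have hf := memHardy_of_mem_hardy hfV.1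
  have hg := memHardy_of_mulOp_sub_mem_orthogonal hV horth
  obtain ⟨a, hq⟩ := hf.exists_ae_eq_neilWeight hg
    (fourierCoeff_zero_eq_zero_of_mulOp_sub_mem_orthogonal hfV horth)
  have ha : a ≠ 0 := by
    rintro rfl
    refine hf0 (Lp.eq_zero_iff_ae_eq_zero.2 <|
      hf.ae_eq_zero_of_sub_mul_ae_eq_zero (ne_zero_of_isLeast hm) hmM hm.1 hM.1 (hq.trans ?_))
    exact ae_of_all _ fun t => by simp [neilWeight]
  have houter := hf.isOuter_of_ae_eq_neilWeight hg ha hq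
  refine ⟨lam, mem_Icc_of_sub_mul_ae_eq_neilWeight hmM hm hM ha hq, f, hfV, ?_,
    houter.fourierCoeff_one_div_eq_logMoment ha hq⟩
  rw [← diskExt_zero]
  exact houter.diskExt_ne_zero 0 (Metric.mem_ball_self one_pos)

end Toeplitz

section EssentialBounds

variable {α : Type*} [MeasurableSpace α] {μ : Measure α} {u : α → ℝ} {s : Set α} {m : ℝ}

theorem isLeast_of_essSup_eq (hs : MeasurableSet s)
    (h : essSup (fun x => (u x : EReal)) (μ.restrict s) = m) :
    IsLeast {r : ℝ | ∀ᵐ x ∂μ, x ∈ s → u x ≤ r} m := by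
  simp only [← ae_restrict_iff' hs, ← EReal.coe_le_coe_iff]
  refine ⟨?_, fun r hr => ?_⟩
  · rw [mem_ofPred_eq, ← h]
    exact ae_le_essSup
  · rw [← EReal.coe_le_coe_iff, ← h]
    exact essSup_le_of_ae_le _ hr

theorem isGreatest_of_essInf_eq (hs : MeasurableSet s)
    (h : essInf (fun x => (u x : EReal)) (μ.restrict s) = m) :
    IsGreatest {r : ℝ | ∀ᵐ x ∂μ, x ∈ s → r ≤ u x} m := by
  simp only [← ae_restrict_iff' hs, ← EReal.coe_le_coe_iff]
  refine ⟨?_, fun r hr => ?_⟩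
  · rw [mem_ofPred_eq, ← h]
    exact ae_essInf_le
  · rw [← EReal.coe_le_coe_iff, ← h]
    exact le_essInf_of_ae_le _ hr

end EssentialBounds

/-! ### The map `Λ` in the affine chart -/

section Herglotz

variable {u : Torus → ℝ} {z : ℂ}

theorem fourier_one_sub_ne_zero (hz : ‖z‖ < 1) (t : Torus) : fourier 1 t - z ≠ 0 :=
  sub_ne_zero.2 fun h => hz.ne (by rw [← h, norm_fourier_apply])

theorem continuous_herglotz (hz : ‖z‖ < 1) : Continuous (herglotz z) :=
  ((map_continuous (fourier 1)).add continuous_const).div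
    ((map_continuous (fourier 1)).sub continuous_const) (fourier_one_sub_ne_zero hz)

theorem herglotz_eq_tsum (hz : ‖z‖ < 1) (t : Torus) :
    herglotz z t = 2 * (∑' n : ℕ, z ^ n * fourier (-n : ℤ) t) - 1 := by
  have hnorm : ‖z * (fourier 1 t)⁻¹‖ < 1 := by
    rwa [norm_mul, norm_inv, norm_fourier_apply, inv_one, mul_one]
  have hpow (n : ℕ) : z ^ n * fourier (-n : ℤ) t = (z * (fourier 1 t)⁻¹) ^ n := by
    rw [mul_pow, inv_pow, ← fourier_natCast, fourier_neg,
      eq_inv_of_mul_eq_one_right (fourier_mul_conj _ t)]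
  have hgeom : (1 - z * (fourier 1 t)⁻¹)⁻¹ = fourier 1 t / (fourier 1 t - z) := by
    rw [← div_eq_mul_inv, one_sub_div (fourier_ne_zero 1 t), inv_div]
  have hne := fourier_one_sub_ne_zero hz t
  rw [tsum_congr hpow, tsum_geometric_of_norm_lt_one hnorm, hgeom, herglotz]
  field_simp
  ring

theorem integral_herglotz_mul (hz : ‖z‖ < 1) (hu : Integrable u arc) :
    ∫ t, herglotz z t * (u t : ℂ) ∂arc =
      2 * diskExt (fun t => (u t : ℂ)) z - fourierCoeff (fun t => (u t : ℂ)) 0 := by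
  have hsummable : Summable fun n : ℕ => ‖z ^ n‖ := by
    simpa only [norm_pow] using summable_geometric_of_lt_one (norm_nonneg z) hz
  have hu' : Integrable (fun t => (u t : ℂ)) arc := hu.ofReal
  have hsum := (hasSum_mul_fourierCoeff hsummable (fun n => n) hu').tsum_eq
  have hint : Integrable (fun t => herglotz z t * (u t : ℂ)) arc :=
    hu'.bdd_mul (continuous_herglotz hz).aestronglyMeasurable
      (ae_of_all _ (ContinuousMap.norm_coe_le_norm ⟨_, continuous_herglotz hz⟩))
  have hdisk : diskExt (fun t => (u t : ℂ)) z =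
      ∫ t, (herglotz z t * (u t : ℂ) + (u t : ℂ)) / 2 ∂arc := by
    simp only [diskExt, mul_comm _ (z ^ _)]
    refine hsum.trans (integral_congr_ae (ae_of_all _ fun t => ?_))
    simp only [herglotz_eq_tsum hz]
    ring
  rw [hdisk, integral_div, integral_add hint hu', fourierCoeff_zero_eq_integral]
  ring

theorem hasDerivAt_outerExp_zero (hu : Integrable u arc) :
    HasDerivAt (outerExp u) (outerExp u 0 * (2 * fourierCoeff (fun t => (u t : ℂ)) 1)) 0 := by
  have hball : Metric.ball (0 : ℂ) 1 ∈ 𝓝 0 := Metric.ball_mem_nhds _ one_pos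
  have hdisk := ((differentiableOn_diskExt fun t => (u t : ℂ)).differentiableAt hball).hasDerivAt
  rw [deriv_diskExt_zero] at hdisk
  have hint : HasDerivAt (fun z => ∫ t, herglotz z t * (u t : ℂ) ∂arc)
      (2 * fourierCoeff (fun t => (u t : ℂ)) 1) 0 :=
    ((hdisk.const_mul 2).sub_const (fourierCoeff (fun t => (u t : ℂ)) 0)).congr_of_eventuallyEq <|
      eventually_of_mem hball fun z hz => integral_herglotz_mul (mem_ball_zero_iff.1 hz) hu
  exact hint.cexp

theorem log_abs_rpow (x p : ℝ) : Real.log (|x| ^ p) = p * Real.log |x| := by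
  obtain rfl | hx := eq_or_ne x 0
  · obtain rfl | hp := eq_or_ne p 0
    · simp
    · simp [Real.zero_rpow hp]
  · exact Real.log_rpow (abs_pos.2 hx) p

end Herglotz

section Lambda

variable {φ : Lp ℝ ∞ arc} {c : ℂ} {lam : ℝ}

theorem hLog_eq (c : ℂ) (t : Torus) : hLog c t = 1 / 2 * Real.log ‖(neilWeight c t : ℂ)‖ := by
  rw [hLog, log_abs_rpow, Complex.norm_real, Real.norm_eq_abs]

theorem gLog_eq (φ : Lp ℝ ∞ arc) (lam : ℝ) (t : Torus) :
    gLog φ lam t = -1 / 2 * Real.log ‖((φ t - lam : ℝ) : ℂ)‖ := by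
  rw [gLog, log_abs_rpow, Complex.norm_real, Real.norm_eq_abs]

theorem integrable_hLog (hc : c ≠ 0) : Integrable (hLog c) arc :=
  (integrable_log_norm_neilWeight hc).const_mul (1 / 2) |>.congr
    (ae_of_all _ fun t => (hLog_eq c t).symm)

theorem deriv_hFun_zero (hc : c ≠ 0) : deriv (hFun c) 0 = 0 := by
  have hcoeff : fourierCoeff (fun t => (hLog c t : ℂ)) 1 = 0 := by
    simp only [hLog_eq, Complex.ofReal_mul]
    rw [fourierCoeff.const_mul]
    exact mul_eq_zero_of_right _ (logCoeff_neilWeight_one c)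
  rw [hFun, (hasDerivAt_outerExp_zero (integrable_hLog hc)).deriv, hcoeff, mul_zero, mul_zero]

theorem deriv_gFun_zero (hg : Integrable (gLog φ lam) arc) :
    deriv (gFun φ lam) 0 = gFun φ lam 0 * logMoment φ lam := by
  have hcoeff : fourierCoeff (fun t => (gLog φ lam t : ℂ)) 1 = 1 / 2 * logMoment φ lam := by
    simp only [gLog_eq, Complex.ofReal_mul]
    rw [fourierCoeff.const_mul, logMoment, logCoeff]
    push_cast
    ring
  rw [gFun, (hasDerivAt_outerExp_zero hg).deriv, hcoeff]
  ring

theorem affineVec_ne_zero (ζ : ℂ) : (!₂[1, ζ] : C2) ≠ 0 := fun h =>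
  one_ne_zero (α := ℂ) (congr_fun (congr_arg WithLp.ofLp h) 0)

/-- The point `[1 : ζ]` of the projective line. -/
noncomputable def affineLine (ζ : ℂ) : ℙ ℂ C2 :=
  Projectivization.mk ℂ !₂[1, ζ] (affineVec_ne_zero ζ)

theorem lamMap_eq_affineLine (hc : c ≠ 0) (hg : Integrable (gLog φ lam) arc) :
    lamMap c φ lam = affineLine (logMoment φ lam) := by
  rw [lamMap, affineLine, Projectivization.mk_eq_mk_iff']
  refine ⟨hFun c 0 * gFun φ lam 0, ?_⟩
  rw [lamVec, deriv_hFun_zero hc, deriv_gFun_zero hg]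
  ext i
  fin_cases i
  · simp
  · simp [mul_assoc]

end Lambda

section ProjectiveLine

variable {𝕜 E : Type*} [RCLike 𝕜] [NormedAddCommGroup E] [InnerProductSpace 𝕜 E]

theorem norm_inv_norm_smul_sub_le {v w : E} (hv : v ≠ 0) (hw : w ≠ 0) :
    ‖((‖v‖⁻¹ : ℝ) : 𝕜) • v - ((‖w‖⁻¹ : ℝ) : 𝕜) • w‖ ≤ 2 * ‖v‖⁻¹ * ‖v - w‖ := by
  have hv0 := norm_pos_iff.2 hv
  have hw0 := norm_pos_iff.2 hw
  have hsplit : ((‖v‖⁻¹ : ℝ) : 𝕜) • v - ((‖w‖⁻¹ : ℝ) : 𝕜) • w =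
      ((‖v‖⁻¹ : ℝ) : 𝕜) • (v - w) + ((‖v‖⁻¹ - ‖w‖⁻¹ : ℝ) : 𝕜) • w := by
    push_cast
    module
  have hscale : ‖((‖v‖⁻¹ - ‖w‖⁻¹ : ℝ) : 𝕜) • w‖ ≤ ‖v‖⁻¹ * ‖v - w‖ := by
    rw [norm_smul, RCLike.norm_ofReal, inv_sub_inv hv0.ne' hw0.ne', abs_div,
      abs_of_pos (mul_pos hv0 hw0), norm_sub_rev v w, div_mul_eq_mul_div,
      mul_div_mul_right _ _ hw0.ne', div_eq_inv_mul]
    gcongr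
    exact abs_norm_sub_norm_le w v
  rw [hsplit]
  refine (norm_add_le _ _).trans ?_
  rw [norm_smul, RCLike.norm_ofReal, abs_of_pos (inv_pos.2 hv0)]
  linarith

theorem norm_starProjection_singleton_sub_le_of_norm_eq_one {u v : E} (hu : ‖u‖ = 1)
    (hv : ‖v‖ = 1) : ‖(𝕜 ∙ u).starProjection - (𝕜 ∙ v).starProjection‖ ≤ 2 * ‖u - v‖ := by
  refine ContinuousLinearMap.opNorm_le_bound _ (by positivity) fun w => ?_
  have hsplit : inner 𝕜 u w • u - inner 𝕜 v w • v =
      inner 𝕜 (u - v) w • u + inner 𝕜 v w • (u - v) := by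
    rw [inner_sub_left]
    module
  rw [sub_apply, Submodule.starProjection_unit_singleton _ hu,
    Submodule.starProjection_unit_singleton _ hv, hsplit]
  calc ‖inner 𝕜 (u - v) w • u + inner 𝕜 v w • (u - v)‖
      ≤ ‖inner 𝕜 (u - v) w‖ * ‖u‖ + ‖inner 𝕜 v w‖ * ‖u - v‖ := by
        rw [← norm_smul, ← norm_smul]
        exact norm_add_le _ _
    _ ≤ ‖u - v‖ * ‖w‖ * ‖u‖ + ‖v‖ * ‖w‖ * ‖u - v‖ := by
        gcongr <;> exact norm_inner_le_norm _ _
    _ = 2 * ‖u - v‖ * ‖w‖ := by rw [hu, hv]; ring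

theorem norm_starProjection_singleton_sub_le {v w : E} (hv : v ≠ 0) (hw : w ≠ 0) :
    ‖(𝕜 ∙ v).starProjection - (𝕜 ∙ w).starProjection‖ ≤ 4 * ‖v‖⁻¹ * ‖v - w‖ := by
  have hunit {x : E} (hx : x ≠ 0) : ‖((‖x‖⁻¹ : ℝ) : 𝕜) • x‖ = 1 := by
    rw [norm_smul, RCLike.norm_ofReal, abs_of_nonneg (by positivity),
      inv_mul_cancel₀ (norm_ne_zero_iff.2 hx)]
  have hspan {x : E} (hx : x ≠ 0) : (𝕜 ∙ x) = 𝕜 ∙ ((‖x‖⁻¹ : ℝ) : 𝕜) • x :=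
    (Submodule.span_singleton_smul_eq (IsUnit.mk0 _ (by simpa using hx)) x).symm
  have hsub := norm_starProjection_singleton_sub_le_of_norm_eq_one (𝕜 := 𝕜) (hunit hv) (hunit hw)
  simp only [← hspan hv, ← hspan hw] at hsub
  linarith [norm_inv_norm_smul_sub_le (𝕜 := 𝕜) hv hw]

theorem lipschitzWith_affineLine : LipschitzWith 4 affineLine := by
  refine LipschitzWith.of_dist_le_mul fun ζ ξ => ?_
  have hnorm : ‖(!₂[1, ζ] : C2)‖⁻¹ ≤ 1 := by
    refine inv_le_one_of_one_le₀ ?_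
    simpa using PiLp.norm_apply_le (!₂[1, ζ] : C2) 0
  have hdist : ‖(!₂[1, ζ] : C2) - !₂[1, ξ]‖ = dist ζ ξ := by
    simp [EuclideanSpace.norm_eq, dist_eq_norm]
  calc dist (affineLine ζ) (affineLine ξ)
      = ‖(ℂ ∙ (!₂[1, ζ] : C2)).starProjection - (ℂ ∙ (!₂[1, ξ] : C2)).starProjection‖ :=
        dist_eq_norm (lineProj _) (lineProj _)
    _ ≤ 4 * ‖(!₂[1, ζ] : C2)‖⁻¹ * ‖(!₂[1, ζ] : C2) - !₂[1, ξ]‖ :=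
        norm_starProjection_singleton_sub_le (affineVec_ne_zero ζ) (affineVec_ne_zero ξ)
    _ ≤ 4 * 1 * dist ζ ξ := by rw [hdist]; gcongr
    _ = (4 : NNReal) * dist ζ ξ := by norm_num

end ProjectiveLine

/-! ### Lipschitz dependence on `λ` -/

section LogLipschitz

variable {X E : Type*} [MeasurableSpace X] {μ : Measure X} [NormedAddCommGroup E] {δ : ℝ}

theorem abs_log_norm_sub_log_norm_le {x y : E} (hδ : 0 < δ) (hx : δ ≤ ‖x‖) (hy : δ ≤ ‖y‖) :
    |Real.log ‖x‖ - Real.log ‖y‖| ≤ δ⁻¹ * ‖x - y‖ := by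
  wlog hxy : Real.log ‖y‖ ≤ Real.log ‖x‖ generalizing x y
  · rw [abs_sub_comm, norm_sub_rev]
    exact this hy hx (le_of_not_ge hxy)
  have hx0 := hδ.trans_le hx
  have hy0 := hδ.trans_le hy
  rw [abs_of_nonneg (sub_nonneg.2 hxy), ← Real.log_div hx0.ne' hy0.ne']
  calc Real.log (‖x‖ / ‖y‖) ≤ ‖x‖ / ‖y‖ - 1 := Real.log_le_sub_one_of_pos (div_pos hx0 hy0)
    _ = ‖y‖⁻¹ * (‖x‖ - ‖y‖) := by field_simp
    _ ≤ ‖y‖⁻¹ * ‖x - y‖ := by gcongr; exact norm_sub_norm_le x y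
    _ ≤ δ⁻¹ * ‖x - y‖ := by gcongr

theorem integrable_log_norm_of_le_norm [IsFiniteMeasure μ] {f : X → E} (hf : Integrable f μ)
    (hδ : 0 < δ) (h : ∀ᵐ x ∂μ, δ ≤ ‖f x‖) : Integrable (fun x => Real.log ‖f x‖) μ := by
  refine ((integrable_const |Real.log δ|).add hf.norm).mono'
    (Real.measurable_log.comp_aemeasurable hf.1.norm.aemeasurable).aestronglyMeasurable ?_
  filter_upwards [h] with x hx
  have hlower := Real.log_le_log hδ hx
  have hupper := Real.log_le_self (norm_nonneg (f x))
  rw [Real.norm_eq_abs, abs_le, Pi.add_apply]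
  constructor
  · linarith [neg_abs_le (Real.log δ), norm_nonneg (f x)]
  · linarith [abs_nonneg (Real.log δ)]

theorem norm_logCoeff_sub_logCoeff_le {T : ℝ} [Fact (0 < T)] {f g : AddCircle T → ℂ}
    (hf : Integrable f haarAddCircle) (hg : Integrable g haarAddCircle) (hδ : 0 < δ)
    (hδf : ∀ᵐ t ∂haarAddCircle, δ ≤ ‖f t‖) (hδg : ∀ᵐ t ∂haarAddCircle, δ ≤ ‖g t‖) (n : ℤ) :
    ‖logCoeff f n - logCoeff g n‖ ≤ δ⁻¹ * ∫ t, ‖f t - g t‖ ∂haarAddCircle := by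
  have hlogf : Integrable (fun t => (Real.log ‖f t‖ : ℂ)) haarAddCircle :=
    (integrable_log_norm_of_le_norm hf hδ hδf).ofReal
  have hlogg : Integrable (fun t => (Real.log ‖g t‖ : ℂ)) haarAddCircle :=
    (integrable_log_norm_of_le_norm hg hδ hδg).ofReal
  rw [logCoeff, logCoeff, ← fourierCoeff_sub hlogf hlogg, ← integral_const_mul]
  refine (norm_fourierCoeff_le _ n).trans
    (integral_mono_ae (hlogf.sub hlogg).norm ((hf.sub hg).norm.const_mul _) ?_)
  filter_upwards [hδf, hδg] with t hft hgt
  rw [← Complex.ofReal_sub, Complex.norm_real]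
  exact abs_log_norm_sub_log_norm_le hδ hft hgt

end LogLipschitz

section LogMoment

variable {φ : Torus → ℝ} {c : ℂ} {m M lam lam' δ : ℝ}

theorem ae_le_or_le (hc : c ≠ 0) (hm : ∀ᵐ t ∂arc, neilWeight c t < 0 → φ t ≤ m)
    (hM : ∀ᵐ t ∂arc, 0 < neilWeight c t → M ≤ φ t) : ∀ᵐ t ∂arc, φ t ≤ m ∨ M ≤ φ t := by
  filter_upwards [hm, hM, ae_neilWeight_ne_zero hc] with t hmt hMt hne
  exact hne.lt_or_gt.imp hmt hMt

theorem ae_le_norm_sub (h : ∀ᵐ t ∂arc, φ t ≤ m ∨ M ≤ φ t) (hm : δ ≤ lam - m)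
    (hM : δ ≤ M - lam) : ∀ᵐ t ∂arc, δ ≤ ‖((φ t - lam : ℝ) : ℂ)‖ := by
  filter_upwards [h] with t ht
  rw [Complex.norm_real, Real.norm_eq_abs]
  exact ht.elim (fun h => le_abs.2 (.inr (by linarith))) fun h => le_abs.2 (.inl (by linarith))

theorem integrable_gLog {φ : Lp ℝ ∞ arc} (h : ∀ᵐ t ∂arc, φ t ≤ m ∨ M ≤ φ t)
    (hlam : lam ∈ Ioo m M) : Integrable (gLog φ lam) arc := by
  have hφ : Integrable φ arc := (Lp.memLp φ).integrable le_top
  simp only [funext (gLog_eq φ lam)]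
  exact (integrable_log_norm_of_le_norm (hφ.sub (integrable_const lam)).ofReal
    (lt_min (sub_pos.2 hlam.1) (sub_pos.2 hlam.2))
    (ae_le_norm_sub h (min_le_left _ _) (min_le_right _ _))).const_mul _

theorem dist_logMoment_le (hφ : Integrable φ arc) (hδ : 0 < δ)
    (h : ∀ᵐ t ∂arc, δ ≤ ‖((φ t - lam : ℝ) : ℂ)‖) (h' : ∀ᵐ t ∂arc, δ ≤ ‖((φ t - lam' : ℝ) : ℂ)‖) :
    dist (logMoment φ lam) (logMoment φ lam') ≤ δ⁻¹ * dist lam lam' := by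
  have hle := norm_logCoeff_sub_logCoeff_le (hφ.sub (integrable_const lam')).ofReal
    (hφ.sub (integrable_const lam)).ofReal hδ h' h 1
  rw [dist_eq_norm, logMoment, logMoment, neg_sub_neg, dist_eq_norm]
  refine hle.trans_eq ?_
  simp [← Complex.ofReal_sub]

theorem locallyLipschitzOn_logMoment (hφ : Integrable φ arc)
    (h : ∀ᵐ t ∂arc, φ t ≤ m ∨ M ≤ φ t) : LocallyLipschitzOn (Ioo m M) (logMoment φ) := by
  intro x hx
  obtain ⟨δ, hδ, hxm, hxM⟩ : ∃ δ > 0, 2 * δ ≤ x - m ∧ 2 * δ ≤ M - x :=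
    ⟨min (x - m) (M - x) / 2, half_pos (lt_min (sub_pos.2 hx.1) (sub_pos.2 hx.2)),
      by linarith [min_le_left (x - m) (M - x)], by linarith [min_le_right (x - m) (M - x)]⟩
  have hgap {y : ℝ} (hy : y ∈ Metric.ball x δ) : ∀ᵐ t ∂arc, δ ≤ ‖((φ t - y : ℝ) : ℂ)‖ := by
    rw [Real.ball_eq_Ioo] at hy
    exact ae_le_norm_sub h (by linarith [hy.1]) (by linarith [hy.2])
  refine ⟨⟨δ⁻¹, (inv_pos.2 hδ).le⟩, Metric.ball x δ,
    mem_nhdsWithin_of_mem_nhds (Metric.ball_mem_nhds x hδ), ?_⟩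
  exact LipschitzOnWith.of_dist_le_mul fun a ha b hb => dist_logMoment_le hφ hδ (hgap ha) (hgap hb)

end LogMoment

/-! ### Hausdorff dimension and the exceptional lines -/

section Dimension

theorem dimH_image_le_one_of_locallyLipschitzOn {X : Type*} [EMetricSpace X] {f : ℝ → X}
    {s : Set ℝ} (hf : LocallyLipschitzOn s f) : dimH (f '' s) ≤ 1 :=
  (dimH_image_le_of_locally_lipschitzOn fun _ hx => hf hx).trans
    ((dimH_mono (subset_univ s)).trans_eq Real.dimH_univ)

theorem infinite_compl_of_dimH_lt_finrank {E : Type*} [NormedAddCommGroup E] [NormedSpace ℝ E]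
    [FiniteDimensional ℝ E] {s : Set E} (hs : dimH s < Module.finrank ℝ E) : sᶜ.Infinite := by
  intro hfin
  have huniv : dimH (s ∪ sᶜ) = dimH s := by rw [dimH_union, dimH_finite hfin, max_eq_left zero_le]
  rw [union_compl_self, Real.dimH_univ_eq_finrank] at huniv
  exact hs.ne' huniv

theorem infinite_compl_image_Icc_of_locallyLipschitzOn_Ioo {f : ℝ → ℂ} {a b : ℝ}
    (hf : LocallyLipschitzOn (Ioo a b) f) : (f '' Icc a b)ᶜ.Infinite := by
  have hsub : f '' Icc a b ⊆ f '' Ioo a b ∪ f '' {a, b} := by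
    rw [← image_union]
    exact image_mono fun x hx => by
      obtain rfl | hxa := hx.1.eq_or_lt
      · simp
      obtain rfl | hxb := hx.2.eq_or_lt
      · simp
      exact .inl ⟨hxa, hxb⟩
  have hdim : dimH (f '' Icc a b) ≤ 1 := by
    refine (dimH_mono hsub).trans ?_
    rw [dimH_union, dimH_finite ((toFinite {a, b}).image f), max_eq_left zero_le]
    exact dimH_image_le_one_of_locallyLipschitzOn hf
  refine infinite_compl_of_dimH_lt_finrank (hdim.trans_lt ?_)
  rw [Complex.finrank_real_complex]
  norm_num

end Dimension

section SlopeSpan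

variable {ζ : ℂ}

/-- The function `z - ζ̄`, for which `⟪z - ζ̄, f⟫ = f'(0) - ζ f(0)` whenever `f ∈ H²`. -/
noncomputable def slopeVec (ζ : ℂ) : L2 := fourierLp 2 1 - conj ζ • fourierLp 2 0

/-- The span of `z - ζ̄`, whose orthogonal complement in `H²` consists of the functions with
`f'(0) = ζ f(0)`. -/
noncomputable def slopeSpan (ζ : ℂ) : Submodule ℂ L2 := ℂ ∙ slopeVec ζ

theorem eq_zero_of_smul_fourierLp_add_smul_fourierLp {a b : ℂ}
    (h : a • (fourierLp 2 1 : L2) + b • (fourierLp 2 0 : L2) = 0) : a = 0 ∧ b = 0 := by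
  have hpair : LinearIndependent ℂ ![(fourierLp 2 1 : L2), fourierLp 2 0] := by
    have hcomp : ![(fourierLp 2 1 : L2), fourierLp 2 0] = fourierLp 2 ∘ ![1, 0] := by
      funext i
      fin_cases i <;> rfl
    rw [hcomp]
    exact orthonormal_fourier.linearIndependent.comp _ (by decide)
  exact LinearIndependent.pair_iff.1 hpair a b h

theorem slopeSpan_ne_bot (ζ : ℂ) : slopeSpan ζ ≠ ⊥ := by
  rw [slopeSpan, Ne, Submodule.span_singleton_eq_bot]
  intro h
  refine one_ne_zero (eq_zero_of_smul_fourierLp_add_smul_fourierLp (b := -conj ζ) ?_).1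
  rw [← h, slopeVec]
  module

theorem slopeSpan_injective : Function.Injective slopeSpan := by
  intro ζ ξ h
  obtain ⟨k, hk⟩ := Submodule.mem_span_singleton.1
    (h ▸ Submodule.mem_span_singleton_self _ : slopeVec ζ ∈ slopeSpan ξ)
  obtain ⟨hz, hone⟩ := eq_zero_of_smul_fourierLp_add_smul_fourierLp
    (a := k - 1) (b := conj ζ - k * conj ξ) <| by
      rw [← sub_eq_zero.2 hk, slopeVec, slopeVec]
      module
  rw [sub_eq_zero.1 hz, one_mul, sub_eq_zero] at hone
  exact star_injective hone

theorem fourierLp_zero_notMem_slopeSpan (ζ : ℂ) : (fourierLp 2 0 : L2) ∉ slopeSpan ζ := by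
  intro h
  obtain ⟨k, hk⟩ := Submodule.mem_span_singleton.1 h
  obtain ⟨hz, hone⟩ := eq_zero_of_smul_fourierLp_add_smul_fourierLp
    (a := k) (b := -(k * conj ζ) - 1) <| by
      rw [← sub_eq_zero.2 hk, slopeVec]
      module
  simp [hz] at hone

theorem slopeSpan_ne_constants (ζ : ℂ) : slopeSpan ζ ≠ constants := fun h =>
  fourierLp_zero_notMem_slopeSpan ζ (h ▸ Submodule.mem_span_singleton_self _)

theorem slopeSpan_lt_linearPolys (ζ : ℂ) : slopeSpan ζ < linearPolys := by
  have h0 : (fourierLp 2 0 : L2) ∈ linearPolys := Submodule.subset_span (mem_insert _ _)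
  have h1 : (fourierLp 2 1 : L2) ∈ linearPolys := Submodule.subset_span (mem_insert_of_mem _ rfl)
  refine lt_of_le_of_ne ?_ fun h => fourierLp_zero_notMem_slopeSpan ζ (h ▸ h0)
  rw [slopeSpan, Submodule.span_singleton_le_iff_mem]
  exact Submodule.sub_mem _ h1 (Submodule.smul_mem _ _ h0)

theorem constants_le_linearPolys : constants ≤ linearPolys :=
  Submodule.span_mono (singleton_subset_iff.2 (mem_insert _ _))

theorem fourierCoeff_zero_of_mem_hardySub_constants {f : L2} (hf : f ∈ hardySub constants) :
    fourierCoeff f 0 = 0 := by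
  rw [← inner_fourierLp]
  exact (Submodule.mem_orthogonal _ _).1 hf.2 _ (Submodule.mem_span_singleton_self _)

theorem fourierCoeff_one_of_mem_hardySub_slopeSpan {f : L2} (hf : f ∈ hardySub (slopeSpan ζ)) :
    fourierCoeff f 1 = ζ * fourierCoeff f 0 := by
  have h := (Submodule.mem_orthogonal _ _).1 hf.2 _ (Submodule.mem_span_singleton_self _)
  rwa [slopeVec, inner_sub_left, inner_smul_left, inner_fourierLp, inner_fourierLp,
    Complex.conj_conj, sub_eq_zero] at h

end SlopeSpan

section Main

variable {φ : Lp ℝ ∞ arc} {c : ℂ} {m M : ℝ}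

theorem noEigenvalues_constants (hmM : m < M)
    (hm : IsLeast {r : ℝ | ∀ᵐ t ∂arc, neilWeight c t < 0 → φ t ≤ r} m)
    (hM : IsGreatest {r : ℝ | ∀ᵐ t ∂arc, 0 < neilWeight c t → r ≤ φ t} M) :
    NoEigenvalues φ constants := fun _ h => by
  obtain ⟨_, _, f, hf, hf0, _⟩ :=
    exists_fourierCoeff_one_div_eq_of_hasEigenvalue hmM hm hM constants_le_linearPolys h
  exact hf0 (fourierCoeff_zero_of_mem_hardySub_constants hf)

theorem noEigenvalues_slopeSpan (hmM : m < M)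
    (hm : IsLeast {r : ℝ | ∀ᵐ t ∂arc, neilWeight c t < 0 → φ t ≤ r} m)
    (hM : IsGreatest {r : ℝ | ∀ᵐ t ∂arc, 0 < neilWeight c t → r ≤ φ t} M) {ζ : ℂ}
    (hζ : ζ ∉ logMoment φ '' Icc m M) : NoEigenvalues φ (slopeSpan ζ) := fun _ h => by
  obtain ⟨lam, hlam, f, hf, hf0, hratio⟩ :=
    exists_fourierCoeff_one_div_eq_of_hasEigenvalue hmM hm hM (slopeSpan_lt_linearPolys ζ).le h
  rw [fourierCoeff_one_of_mem_hardySub_slopeSpan hf, mul_div_cancel_right₀ _ hf0] at hratio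
  exact hζ ⟨lam, hlam, hratio.symm⟩

theorem locallyLipschitzOn_lamMap (hc : c ≠ 0) (h : ∀ᵐ t ∂arc, φ t ≤ m ∨ M ≤ φ t) :
    LocallyLipschitzOn (Ioo m M) (lamMap c φ) := by
  intro x hx
  obtain ⟨K, t, ht, hK⟩ := locallyLipschitzOn_logMoment ((Lp.memLp φ).integrable le_top) h hx
  have hline : ∀ lam ∈ Ioo m M, lamMap c φ lam = affineLine (logMoment φ lam) := fun _ hlam =>
    lamMap_eq_affineLine hc (integrable_gLog h hlam)
  refine ⟨4 * K, t ∩ Ioo m M, inter_mem ht self_mem_nhdsWithin, fun y hy z hz => ?_⟩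
  rw [hline y hy.2, hline z hz.2]
  exact lipschitzWith_affineLine.comp_lipschitzOnWith (hK.mono inter_subset_left) hy hz

end Main

end NeilParabola

theorem corollary3p5_general (φ : Lp ℝ ∞ arc) (c : ℂ) (m M : ℝ)
    (hm : essSup (fun t => ((φ t : ℝ) : EReal)) (arc.restrict {t | neilWeight c t < 0})
      = (m : EReal))
    (hM : essInf (fun t => ((φ t : ℝ) : EReal)) (arc.restrict {t | 0 < neilWeight c t})
      = (M : EReal))
    (hmM : m < M) :
    (Integrable (hLog c) arc ∧ DifferentiableAt ℂ (hFun c) 0 ∧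
      ∀ lam ∈ Ioo m M, Integrable (gLog φ lam) arc ∧ DifferentiableAt ℂ (gFun φ lam) 0) ∧
    LocallyLipschitzOn (Ioo m M) (lamMap c φ) ∧
    dimH (lamMap c φ '' Ioo m M) ≤ 1 ∧
    NoEigenvalues φ constants ∧
    {V : Submodule ℂ L2 |
      V ≠ ⊥ ∧ V < linearPolys ∧ V ≠ constants ∧ NoEigenvalues φ V}.Infinite := by
  have hw := (continuous_neilWeight c).measurable
  have hm' := isLeast_of_essSup_eq (measurableSet_lt hw measurable_const) hm
  have hM' := isGreatest_of_essInf_eq (measurableSet_lt measurable_const hw) hM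
  have hc : c ≠ 0 := ne_zero_of_isLeast hm'
  have hgap : ∀ᵐ t ∂arc, φ t ≤ m ∨ M ≤ φ t := ae_le_or_le hc hm'.1 hM'.1
  have hh := integrable_hLog hc
  have hΛ : LocallyLipschitzOn (Ioo m M) (lamMap c φ) := locallyLipschitzOn_lamMap hc hgap
  have hmoment : (logMoment φ '' Icc m M)ᶜ.Infinite :=
    infinite_compl_image_Icc_of_locallyLipschitzOn_Ioo
      (locallyLipschitzOn_logMoment ((Lp.memLp φ).integrable le_top) hgap)
  refine ⟨⟨hh, (hasDerivAt_outerExp_zero hh).differentiableAt, fun lam hlam =>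
      ⟨integrable_gLog hgap hlam,
        (hasDerivAt_outerExp_zero (integrable_gLog hgap hlam)).differentiableAt⟩⟩,
    hΛ, dimH_image_le_one_of_locallyLipschitzOn hΛ, noEigenvalues_constants hmM hm' hM', ?_⟩
  refine (hmoment.image slopeSpan_injective.injOn).mono ?_
  rintro _ ⟨ζ, hζ, rfl⟩
  exact ⟨slopeSpan_ne_bot ζ, slopeSpan_lt_linearPolys ζ, slopeSpan_ne_constants ζ,
    noEigenvalues_slopeSpan hmM hm' hM' hζ⟩

theorem corollary3p5 (φ : Lp ℝ ∞ arc) (c : ℂ) (m M : ℝ)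
    (hm : essSup (fun t => ((φ t : ℝ) : EReal)) (arc.restrict {t | neilWeight c t < 0})
      = (m : EReal))
    (hM : essInf (fun t => ((φ t : ℝ) : EReal)) (arc.restrict {t | 0 < neilWeight c t})
      = (M : EReal))
    (hm0 : m < 0) (hM0 : 0 < M) :
    -- the functions that define `Λ` make sense
    (Integrable (hLog c) arc ∧ DifferentiableAt ℂ (hFun c) 0 ∧
      ∀ lam ∈ Ioo m M, Integrable (gLog φ lam) arc ∧ DifferentiableAt ℂ (gFun φ lam) 0) ∧
    -- `Λ` is locally Lipschitz on `(m, M)`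
    LocallyLipschitzOn (Ioo m M) (lamMap c φ) ∧
    -- its image has Hausdorff dimension at most one
    dimH (lamMap c φ '' Ioo m M) ≤ 1 ∧
    -- there are no eigenvalues for the span of `1`
    NoEigenvalues φ constants ∧
    -- nor for infinitely many other nonzero proper subspaces of `ℂ ⊕ ℂ z`
    {V : Submodule ℂ L2 | V ≠ ⊥ ∧ V < linearPolys ∧ V ≠ constants ∧ NoEigenvalues φ V}.Infinite :=
  corollary3p5_general φ c m M hm hM (hm0.trans hM0)
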